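/- **Setting.** Let $n=n_t\ge 1$, $m=n(n-1)/2$, and let $G$ be an $n\times n$ complex Hermitian matrix with eigenvalues $\lambda_1,\dots,\lambda_n$ (with multiplicity). $\|\cdot\|$ is the Frobenius norm. $R_{l,m'}(\theta,\phi)$ is the identity matrix except that its $l$th and $m'$th diagonal entries are $\cos\theta$, its $(m',l)$ entry is $e^{-i\phi}\sin\theta$ and its $(l,m')$ entry is $-e^{i\phi}\sin\theta$; $r_{l,m'}(\theta,\phi)$ is its $l$th column; $S(A,x)=x^*Ax$. **Modified OBNSLA with line search accuracy $\eta\ge 0$.** Put $W_0=I$, $A_k=W_k^*GW_k$, and let $P_k$ be the Frobenius norm of the strictly upper triangular part of $A_k$. The pairs $(l_k,m_k)$, $k=1,2,\dots$, run periodically through the row-cyclic order $(1,2),(1,3),\dots,(1,n),(2,3),\dots,(n-1,n)$; $m$ consecutive rotations, starting at $(1,2)$, are a sweep. The $k$th rotation is $W_k=W_{k-1}R_{l_k,m_k}(\theta_k,\phi_k)$, where $|\phi_k-\phi_k^{J}|\le\eta$ for some minimizer $\phi_k^{J}$ of $\phi\mapsto S(A_{k-1},r_{l_k,m_k}(\pi/4,\phi))$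 on $[-\pi,\pi]$, and $|\theta_k-T(\tilde\theta_k)|\le\eta$ for some minimizer $\tilde\theta_k$ of $\theta\mapsto S(A_{k-1},r_{l_k,m_k}(\theta,\phi_k))$ on $[-\pi/2,\pi/2]$, where $T(t)=t$ if $|t|\le\pi/4$ and $T(t)=t-\operatorname{sign}(t)\pi/2$ otherwise. At the beginning of each sweep a permutation $I$ of $\{1,\dots,n\}$ is set to the identity; after the $k$th rotation, with $a_{ij}$ the entries of $W_k^*GW_k$, the values $I(l_k)$ and $I(m_k)$ are exchanged if $a_{I(l_k)I(l_k)}<a_{I(m_k)I(m_k)}$; at the end of the sweep the columns of $W_k$ are permuted so that the $l$th column becomes the former $I(l)$th column. **Theorem.** For every $n$ there is a constant $C>0$, depending only on $n$, such that the following holds for every $G$, every $\eta\ge0$ and every run of the modified OBNSLA. Let $L=\{1,\dots,n\}$ and let $L_2\subset L$ be such that $\lambda_l=\lambda+\xi_l$ for $l\in L_2$, with $\sum_{l\in L_2}\xi_l=0$. Let $\delta_c$ satisfy $\delta_c>16\sqrt{\sum_{l\in L_2}\xi_l^2}$ and $3\delta_c\le x$ for every $x\in\Lambda_1\cup\Lambda_2$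 (for instance $3\delta_c=\min(\Lambda_1\cup\Lambda_2)$), where $$\Lambda_1=\{|\lambda_l-\lambda_r| : l,r\in L\setminus L_2,\ \lambda_l\ne\lambda_r\},\qquad \Lambda_2=\{|\lambda_l-\lambda| : l\in L\setminus L_2\}.$$ If at a stage $k$ at which a sweep begins (that is, $k$ is a multiple of $m$) $$2\delta_c\sqrt{\textstyle\sum_{l\in L_2}\xi_l^2}\le P_k^2\le\delta_c^2/8 ,$$ and the lower bound still holds one sweep later, $2\delta_c\sqrt{\sum_{l\in L_2}\xi_l^2}\le P_{k+m}^2$, then $$P_{k+2m}^2\le C\Big(\frac{P_{k+m}^2}{\delta_c}\Big)^2+C\,\frac{\eta P_{k+m}^3}{\delta_c}+C\,\frac{\eta^2P_{k+m}}{\delta_c}+2(n^2-n)\,\eta^2\|G\|^2 .$$ -/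

import Mathlib

open scoped Matrix

namespace OBNSLA

/-- Frobenius norm of a complex square matrix. -/
noncomputable def frobNorm {n : ℕ} (A : Matrix (Fin n) (Fin n) ℂ) : ℝ :=
  letI := Matrix.frobeniusNormedAddCommGroup (m := Fin n) (n := Fin n) (α := ℂ)
  ‖A‖

/-- Frobenius norm of the strictly upper triangular part. -/
noncomputable def offNorm {n : ℕ} (A : Matrix (Fin n) (Fin n) ℂ) : ℝ :=
  frobNorm (Matrix.of fun i j => if i < j then A i j else 0)

/-- The plane rotation `R_{l,m}(θ, φ)`: the identity matrix, except that the `l`th and `m`th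
diagonal entries are `cos θ`, the `(m,l)` entry is `e^{-iφ} sin θ` and the `(l,m)` entry is
`-e^{iφ} sin θ`. -/
noncomputable def planeRotation {n : ℕ} (l m : Fin n) (θ φ : ℝ) : Matrix (Fin n) (Fin n) ℂ :=
  Matrix.of fun i j =>
    if i = j then (if i = l ∨ i = m then (Real.cos θ : ℂ) else 1)
    else if i = m ∧ j = l then Complex.exp (-(φ * Complex.I)) * (Real.sin θ : ℂ)
    else if i = l ∧ j = m then -(Complex.exp (φ * Complex.I) * (Real.sin θ : ℂ))
    else 0

/-- `S(A, r_{l,m}(θ, φ))`, where `S(A, x) = x^* A x` (real for Hermitian `A`) and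
`r_{l,m}(θ, φ)` is the `l`th column of `R_{l,m}(θ, φ)`. -/
noncomputable def objective {n : ℕ} (A : Matrix (Fin n) (Fin n) ℂ) (l m : Fin n)
    (θ φ : ℝ) : ℝ :=
  (star (fun i => planeRotation l m θ φ i l) ⬝ᵥ (A *ᵥ fun i => planeRotation l m θ φ i l)).re

/-- Reduction of an angle of `[-π/2, π/2]` to `[-π/4, π/4]` by a shift of `π/2`. -/
noncomputable def foldAngle (t : ℝ) : ℝ :=
  if -(Real.pi / 4) ≤ t ∧ t ≤ Real.pi / 4 then t
  else t - (if 0 < t then 1 else -1) * (Real.pi / 2)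

/-- `(θ, φ)` is a possible outcome of the two line searches of accuracy `η` for the pair `(l, m)`:
`φ` is within `η` of a minimizer over `[-π, π]` of `S(A, r(π/4, ·))`, and `θ` is within `η` of the
folded minimizer over `[-π/2, π/2]` of `S(A, r(·, φ))`, for the value `φ` already found. -/
def LineSearchOutcome {n : ℕ} (η : ℝ) (A : Matrix (Fin n) (Fin n) ℂ) (l m : Fin n)
    (θ φ : ℝ) : Prop :=
  (∃ φJ ∈ Set.Icc (-Real.pi) Real.pi,
    IsMinOn (fun ψ => objective A l m (Real.pi / 4) ψ) (Set.Icc (-Real.pi) Real.pi) φJ ∧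
      |φ - φJ| ≤ η) ∧
  (∃ t ∈ Set.Icc (-(Real.pi / 2)) (Real.pi / 2),
    IsMinOn (fun s => objective A l m s φ) (Set.Icc (-(Real.pi / 2)) (Real.pi / 2)) t ∧
      |θ - foldAngle t| ≤ η)

/-- The number `n(n-1)/2` of rotations in a sweep. -/
def sweepLength (n : ℕ) : ℕ := n * (n - 1) / 2

/-- The index pairs in row-cyclic order: `(1,2), (1,3), …, (1,n), (2,3), …, (n-1,n)`. -/
def sweepPairs (n : ℕ) : List (Fin n × Fin n) :=
  (List.finRange n).flatMap fun l =>
    ((List.finRange n).filter fun m => l < m).map fun m => (l, m)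

/-- The pair of the rotation that leads from stage `k` to stage `k + 1`
(there is none only if `n ≤ 1`). -/
def pairAt (n k : ℕ) : Option (Fin n × Fin n) :=
  (sweepPairs n)[k % sweepLength n]?

/-- Update of the column table `I` for the pair `(l, m)`: the two positions exchange their columns
if the diagonal entry of the column recorded for `l` is less than that of the one recorded
for `m`. -/
noncomputable def updateTable {n : ℕ} (A : Matrix (Fin n) (Fin n) ℂ) (I : Equiv.Perm (Fin n))
    (l m : Fin n) : Equiv.Perm (Fin n) :=
  if (A (I m) (I m)).re ≤ (A (I l) (I l)).re then I else I * Equiv.swap l m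

/-- The pair `(W_k, I)` of the modified algorithm after `k` rotations; `θ k` and `φ k` are the
angles of the rotation leading from stage `k` to stage `k + 1`. The table `I` is the identity at the
beginning of a sweep; at the end of a sweep the `l`th column of `W` is replaced by its `I(l)`th
column. -/
noncomputable def state {n : ℕ} (G : Matrix (Fin n) (Fin n) ℂ) (θ φ : ℕ → ℝ) :
    ℕ → Matrix (Fin n) (Fin n) ℂ × Equiv.Perm (Fin n)
  | 0 => (1, 1)
  | k + 1 =>
    match pairAt n k with
    | none => state G θ φ k
    | some (l, m) =>
      let W := (state G θ φ k).1 * planeRotation l m (θ k) (φ k)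
      let I := updateTable (Wᴴ * G * W) (state G θ φ k).2 l m
      if (k + 1) % sweepLength n = 0 then (W.submatrix id I, 1) else (W, I)

/-- `A_k = W_k^* G W_k`. -/
noncomputable def iterate {n : ℕ} (G : Matrix (Fin n) (Fin n) ℂ) (θ φ : ℕ → ℝ) (k : ℕ) :
    Matrix (Fin n) (Fin n) ℂ :=
  (state G θ φ k).1ᴴ * G * (state G θ φ k).1

/-- `P_k`, the Frobenius norm of the strictly upper triangular part of `A_k`. -/
noncomputable def P {n : ℕ} (G : Matrix (Fin n) (Fin n) ℂ) (θ φ : ℕ → ℝ) (k : ℕ) : ℝ :=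
  offNorm (iterate G θ φ k)

/-- The angle sequences `θ`, `φ` are those of a run of the modified algorithm on `G` with line
searches of accuracy `η`. -/
def IsRun {n : ℕ} (G : Matrix (Fin n) (Fin n) ℂ) (η : ℝ) (θ φ : ℕ → ℝ) : Prop :=
  ∀ (k : ℕ) (l m : Fin n), pairAt n k = some (l, m) →
    LineSearchOutcome η (iterate G θ φ k) l m (θ k) (φ k)

/-- The distances between distinct eigenvalues outside the cluster `L₂`, and those from the
eigenvalues outside the cluster to its centre `c`. -/
def gaps {n : ℕ} (ev : Fin n → ℝ) (L₂ : Finset (Fin n)) (c : ℝ) : Set ℝ :=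
  {x | ∃ l r, l ∉ L₂ ∧ r ∉ L₂ ∧ ev l ≠ ev r ∧ x = |ev l - ev r|} ∪
    {x | ∃ l, l ∉ L₂ ∧ x = |ev l - c|}

end OBNSLA

/-! Every eigenvalue lies within `s` (the norm of the `ξ l`) of a centre, and distinct centres are
at least `3 * δ` apart. While the off-diagonal norm is small against `δ`, each diagonal entry is
close to one centre, and a rotation with folded angle moves it too little to reach another. The
table updates of the first sweep therefore compare centres, and as an exchange sort they leave equal
centres contiguous (`IsSweep.diag_near`, `IsSweep.antitone_table`).

In the second sweep let `P` be the initial off-diagonal norm. A rotation between different clusters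
has an angle of order `P / δ`, so it changes the other off-diagonal entries by order `P ^ 2 / δ` and
leaves a pivot of order `η * ‖G‖`. A rotation inside a cluster may have a large angle, but by
contiguity the positions already treated contain both or neither of its two rows, so their sum of
squares is unchanged. Summing over the sweep controls all entries between clusters
(`IsSweep.frobNorm_treated_step`). Entries inside a cluster need no dynamics: by the spectral
decomposition they are at most `s` plus order `P ^ 2 / δ` (`Clustered.norm_apply_le`), and the lower
bound on `P ^ 2` makes `s` of the same order.

This argument needs `P` small against `δ` and line search errors small against `P`. Otherwise the
near-monotonicity of the off-diagonal norm (`IsSweep.offNorm_sq_le`) suffices. The two mixed terms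
of the bound are only added as nonnegative quantities. -/

namespace OBNSLA

variable {n : ℕ}

/-! ### Frobenius norms and sums of squares over sets of positions. -/

lemma frobNorm_sq (A : Matrix (Fin n) (Fin n) ℂ) :
    frobNorm A ^ 2 = ∑ i, ∑ j, ‖A i j‖ ^ 2 := by
  have h : 0 ≤ ∑ i, ∑ j, ‖A i j‖ ^ 2 := by positivity
  rw [frobNorm, Matrix.frobenius_norm_def, ← Real.sqrt_eq_rpow]
  simp only [Real.rpow_two]
  exact Real.sq_sqrt h

lemma frobNorm_nonneg (A : Matrix (Fin n) (Fin n) ℂ) : 0 ≤ frobNorm A := by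
  let _ := Matrix.frobeniusNormedAddCommGroup (m := Fin n) (n := Fin n) (α := ℂ)
  exact norm_nonneg A

lemma frobNorm_add_le (A B : Matrix (Fin n) (Fin n) ℂ) :
    frobNorm (A + B) ≤ frobNorm A + frobNorm B := by
  let _ := Matrix.frobeniusNormedAddCommGroup (m := Fin n) (n := Fin n) (α := ℂ)
  exact norm_add_le A B

lemma frobNorm_sq_eq_trace (A : Matrix (Fin n) (Fin n) ℂ) :
    frobNorm A ^ 2 = (Aᴴ * A).trace.re := by
  rw [frobNorm_sq, Finset.sum_comm, Matrix.trace, Complex.re_sum]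
  refine Finset.sum_congr rfl fun j _ => ?_
  rw [Matrix.diag_apply, Matrix.mul_apply, Complex.re_sum]
  refine Finset.sum_congr rfl fun i _ => ?_
  rw [Matrix.conjTranspose_apply, Complex.star_def, ← Complex.normSq_eq_conj_mul_self,
    Complex.ofReal_re, Complex.normSq_eq_norm_sq]

lemma frobNorm_conj {A R : Matrix (Fin n) (Fin n) ℂ} (h : R * Rᴴ = 1) :
    frobNorm (Rᴴ * A * R) = frobNorm A := by
  refine (sq_eq_sq₀ (frobNorm_nonneg _) (frobNorm_nonneg _)).1 ?_
  rw [frobNorm_sq_eq_trace, frobNorm_sq_eq_trace, Matrix.trace_mul_comm]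
  have : Rᴴ * A * R * (Rᴴ * A * R)ᴴ = Rᴴ * (A * (R * Rᴴ) * Aᴴ * R) := by
    simp [Matrix.mul_assoc]
  rw [this, h, Matrix.trace_mul_comm]
  simp only [Matrix.mul_assoc, h, Matrix.mul_one]
  rw [Matrix.trace_mul_comm]

open Classical in
/-- The entries of `A` at the positions selected by `T`, and zeros elsewhere. -/
noncomputable def mask (T : Fin n → Fin n → Prop) (A : Matrix (Fin n) (Fin n) ℂ) :
    Matrix (Fin n) (Fin n) ℂ :=
  Matrix.of fun i j => if T i j then A i j else 0

open Classical in
lemma mask_apply (T : Fin n → Fin n → Prop) (A : Matrix (Fin n) (Fin n) ℂ) (i j : Fin n) :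
    mask T A i j = if T i j then A i j else 0 := rfl

lemma frobNorm_mask_sq (T : Fin n → Fin n → Prop) [∀ i j, Decidable (T i j)]
    (A : Matrix (Fin n) (Fin n) ℂ) :
    frobNorm (mask T A) ^ 2 = ∑ i, ∑ j, if T i j then ‖A i j‖ ^ 2 else 0 := by
  rw [frobNorm_sq]
  refine Finset.sum_congr rfl fun i _ => Finset.sum_congr rfl fun j _ => ?_
  rw [mask_apply]
  by_cases h : T i j <;> simp [h]

lemma offNorm_nonneg (A : Matrix (Fin n) (Fin n) ℂ) : 0 ≤ offNorm A := frobNorm_nonneg _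

lemma norm_apply_comm {A : Matrix (Fin n) (Fin n) ℂ} (hA : A.IsHermitian) (i j : Fin n) :
    ‖A i j‖ = ‖A j i‖ := by
  rw [← hA.apply j i, norm_star]

/-- The passage from the upper triangle, which rotations and permutations do not respect, to a
symmetric set of positions, to which invariance arguments apply. -/
lemma offNorm_sq {A : Matrix (Fin n) (Fin n) ℂ} (hA : A.IsHermitian) :
    2 * offNorm A ^ 2 = frobNorm (mask (· ≠ ·) A) ^ 2 := by
  have h : offNorm A ^ 2 = ∑ i, ∑ j, if i < j then ‖A i j‖ ^ 2 else 0 := by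
    rw [offNorm, frobNorm_sq]
    refine Finset.sum_congr rfl fun i _ => Finset.sum_congr rfl fun j _ => ?_
    rw [Matrix.of_apply]
    split_ifs <;> simp
  have h' : offNorm A ^ 2 = ∑ i, ∑ j, if j < i then ‖A i j‖ ^ 2 else 0 := by
    rw [h, Finset.sum_comm]
    simp only [norm_apply_comm hA]
  rw [two_mul, frobNorm_mask_sq]
  nth_rw 1 [h]
  rw [h', ← Finset.sum_add_distrib]
  refine Finset.sum_congr rfl fun i _ => ?_
  rw [← Finset.sum_add_distrib]
  refine Finset.sum_congr rfl fun j _ => ?_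
  rcases lt_trichotomy i j with hij | hij | hij
  · simp [hij, hij.ne, hij.not_gt]
  · simp [hij]
  · simp [hij, hij.ne', hij.not_gt]

/-- Row `i` and column `i` are disjoint off the diagonal and have equal sums, which absorbs the
factor 2 of `offNorm_sq`. -/
lemma sum_row_le_offNorm_sq {A : Matrix (Fin n) (Fin n) ℂ} (hA : A.IsHermitian) (i : Fin n) :
    ∑ j, (if j ≠ i then ‖A i j‖ ^ 2 else 0) ≤ offNorm A ^ 2 := by
  have h : ∑ a, ∑ b, ((if a = i then if b ≠ i then ‖A i b‖ ^ 2 else 0 else 0) +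
      (if b = i then if a ≠ i then ‖A i a‖ ^ 2 else 0 else 0)) ≤
      ∑ a, ∑ b, if a ≠ b then ‖A a b‖ ^ 2 else 0 := by
    refine Finset.sum_le_sum fun a _ => Finset.sum_le_sum fun b _ => ?_
    by_cases ha : a = i <;> by_cases hb : b = i
    · simp [ha, hb]
    · simp [ha, hb, Ne.symm hb]
    · simp [ha, hb, norm_apply_comm hA i a]
    · simp only [ha, hb, if_false, add_zero]
      split_ifs <;> positivity
  have h2 := offNorm_sq hA
  rw [frobNorm_mask_sq] at h2
  simp only [Finset.sum_add_distrib, Finset.sum_ite_eq', Finset.mem_univ, if_true] at h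
  rw [Finset.sum_comm] at h
  simp only [Finset.sum_ite_eq', Finset.mem_univ, if_true] at h
  linarith

lemma norm_apply_le_offNorm {A : Matrix (Fin n) (Fin n) ℂ} (hA : A.IsHermitian) {i j : Fin n}
    (hij : i ≠ j) : ‖A i j‖ ≤ offNorm A := by
  refine (sq_le_sq₀ (norm_nonneg _) (offNorm_nonneg A)).1 (le_trans ?_ (sum_row_le_offNorm_sq hA i))
  refine le_trans ?_ (Finset.single_le_sum (fun j _ => ?_) (Finset.mem_univ j))
  · rw [if_pos hij.symm]
  · split_ifs <;> positivity

lemma block_le_frobNorm_sq {A : Matrix (Fin n) (Fin n) ℂ} (hA : A.IsHermitian) {l m : Fin n}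
    (hlm : l ≠ m) : ‖A l l‖ ^ 2 + ‖A m m‖ ^ 2 + 2 * ‖A l m‖ ^ 2 ≤ frobNorm A ^ 2 := by
  have key : ∀ f : Fin n → ℝ, (∀ i, 0 ≤ f i) → f l + f m ≤ ∑ i, f i := fun f hf => by
    rw [← Finset.sum_pair hlm]
    exact Finset.sum_le_univ_sum_of_nonneg hf
  rw [frobNorm_sq]
  have h := key (fun i => ∑ j, ‖A i j‖ ^ 2) fun i => by positivity
  have h1 := key (fun j => ‖A l j‖ ^ 2) fun i => by positivity
  have h2 := key (fun j => ‖A m j‖ ^ 2) fun i => by positivity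
  have h3 := norm_apply_comm hA l m
  simp only [← h3] at h h1 h2 ⊢
  linarith

/-! ### Plane rotations -/

/-- The entry of a plane rotation at the position `(m, l)`. -/
noncomputable def rotSin (θ φ : ℝ) : ℂ := Complex.exp (-(φ * Complex.I)) * (Real.sin θ : ℂ)

lemma star_rotSin (θ φ : ℝ) :
    star (rotSin θ φ) = Complex.exp (φ * Complex.I) * (Real.sin θ : ℂ) := by
  rw [rotSin, Complex.star_def, map_mul, ← Complex.exp_conj, Complex.conj_ofReal]
  simp

lemma norm_rotSin (θ φ : ℝ) : ‖rotSin θ φ‖ = |Real.sin θ| := by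
  have : -((φ : ℂ) * Complex.I) = ((-φ : ℝ) : ℂ) * Complex.I := by push_cast; ring
  rw [rotSin, norm_mul, this, Complex.norm_exp_ofReal_mul_I, one_mul, Complex.norm_real,
    Real.norm_eq_abs]

lemma cos_sq_add_rotSin (θ φ : ℝ) :
    (Real.cos θ : ℂ) * Real.cos θ + star (rotSin θ φ) * rotSin θ φ = 1 := by
  rw [Complex.star_def, ← Complex.normSq_eq_conj_mul_self, Complex.normSq_eq_norm_sq, norm_rotSin,
    sq_abs]
  norm_cast
  rw [← sq, Real.cos_sq_add_sin_sq]

lemma star_ofReal_cos (θ : ℝ) : star (Real.cos θ : ℂ) = Real.cos θ := Complex.conj_ofReal _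

lemma mul_planeRotation_left {l m : Fin n} (hlm : l ≠ m) (θ φ : ℝ)
    (A : Matrix (Fin n) (Fin n) ℂ) (x : Fin n) :
    (A * planeRotation l m θ φ) x l = A x l * Real.cos θ + A x m * rotSin θ φ := by
  have : ∀ y, A x y * planeRotation l m θ φ y l =
      (if y = l then A x y * Real.cos θ else 0) + (if y = m then A x y * rotSin θ φ else 0) := by
    intro y
    by_cases h1 : y = l
    · simp [planeRotation, h1, hlm]
    · by_cases h2 : y = m <;> simp [planeRotation, h1, h2, hlm, hlm.symm, rotSin]
  rw [Matrix.mul_apply, Finset.sum_congr rfl fun y _ => this y, Finset.sum_add_distrib]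
  simp

lemma mul_planeRotation_right {l m : Fin n} (hlm : l ≠ m) (θ φ : ℝ)
    (A : Matrix (Fin n) (Fin n) ℂ) (x : Fin n) :
    (A * planeRotation l m θ φ) x m = A x m * Real.cos θ - A x l * star (rotSin θ φ) := by
  have : ∀ y, A x y * planeRotation l m θ φ y m =
      (if y = m then A x y * Real.cos θ else 0) +
        (if y = l then -(A x y * star (rotSin θ φ)) else 0) := by
    intro y
    by_cases h1 : y = m
    · simp [planeRotation, h1, hlm.symm]
    · by_cases h2 : y = l
      · simp only [star_rotSin]
        simp [planeRotation, h2, hlm]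
      · simp [planeRotation, h1, h2]
  rw [Matrix.mul_apply, Finset.sum_congr rfl fun y _ => this y, Finset.sum_add_distrib]
  simp [sub_eq_add_neg]

lemma mul_planeRotation_other {l m : Fin n} (θ φ : ℝ)
    (A : Matrix (Fin n) (Fin n) ℂ) (x : Fin n) {j : Fin n} (hl : j ≠ l) (hm : j ≠ m) :
    (A * planeRotation l m θ φ) x j = A x j := by
  have : ∀ y, A x y * planeRotation l m θ φ y j = if y = j then A x y else 0 := by
    intro y
    by_cases h1 : y = j
    · simp [planeRotation, h1, hl, hm]
    · simp [planeRotation, h1, hl, hm]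
  rw [Matrix.mul_apply, Finset.sum_congr rfl fun y _ => this y]
  simp

lemma planeRotation_mul_apply (l m : Fin n) (θ φ : ℝ) (B : Matrix (Fin n) (Fin n) ℂ)
    (i j : Fin n) :
    ((planeRotation l m θ φ)ᴴ * B) i j = star ((Bᴴ * planeRotation l m θ φ) j i) := by
  rw [← Matrix.conjTranspose_apply, Matrix.conjTranspose_mul, Matrix.conjTranspose_conjTranspose]

lemma planeRotation_mul_left {l m : Fin n} (hlm : l ≠ m) (θ φ : ℝ)
    (B : Matrix (Fin n) (Fin n) ℂ) (x : Fin n) :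
    ((planeRotation l m θ φ)ᴴ * B) l x = Real.cos θ * B l x + star (rotSin θ φ) * B m x := by
  rw [planeRotation_mul_apply, mul_planeRotation_left hlm, star_add, star_mul, star_mul,
    Matrix.conjTranspose_apply, Matrix.conjTranspose_apply, star_star, star_star, star_ofReal_cos]

lemma planeRotation_mul_right {l m : Fin n} (hlm : l ≠ m) (θ φ : ℝ)
    (B : Matrix (Fin n) (Fin n) ℂ) (x : Fin n) :
    ((planeRotation l m θ φ)ᴴ * B) m x = Real.cos θ * B m x - rotSin θ φ * B l x := by
  rw [planeRotation_mul_apply, mul_planeRotation_right hlm, star_sub, star_mul, star_mul,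
    Matrix.conjTranspose_apply, Matrix.conjTranspose_apply, star_star, star_star, star_star, star_ofReal_cos]

lemma planeRotation_mul_other {l m : Fin n} (θ φ : ℝ)
    (B : Matrix (Fin n) (Fin n) ℂ) (x : Fin n) {i : Fin n} (hl : i ≠ l) (hm : i ≠ m) :
    ((planeRotation l m θ φ)ᴴ * B) i x = B i x := by
  rw [planeRotation_mul_apply, mul_planeRotation_other _ _ _ _ hl hm, Matrix.conjTranspose_apply,
    star_star]

lemma planeRotation_unitary {l m : Fin n} (hlm : l ≠ m) (θ φ : ℝ) :
    planeRotation l m θ φ * (planeRotation l m θ φ)ᴴ = 1 := by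
  have hcs := cos_sq_add_rotSin θ φ
  rw [mul_eq_one_comm]
  have hR : planeRotation l m θ φ = 1 * planeRotation l m θ φ := (one_mul _).symm
  ext i j
  by_cases hil : i = l
  · subst hil
    rw [planeRotation_mul_left hlm, hR]
    by_cases hj : j = i
    · subst hj
      rw [mul_planeRotation_left hlm, mul_planeRotation_left hlm]
      simp [hlm, hlm.symm]
      simpa using hcs
    by_cases hj' : j = m
    · subst hj'
      rw [mul_planeRotation_right hlm, mul_planeRotation_right hlm]
      simp [hlm, hlm.symm]
      ring
    · rw [mul_planeRotation_other _ _ _ _ hj hj', mul_planeRotation_other _ _ _ _ hj hj']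
      simp [Ne.symm hj, Ne.symm hj']
  by_cases him : i = m
  · subst him
    rw [planeRotation_mul_right hlm, hR]
    by_cases hj : j = l
    · subst hj
      rw [mul_planeRotation_left hlm, mul_planeRotation_left hlm]
      simp [hlm, hlm.symm]
      ring
    by_cases hj' : j = i
    · subst hj'
      rw [mul_planeRotation_right hlm, mul_planeRotation_right hlm]
      simp [hlm, hlm.symm]
      rw [← hcs]
      simp
      ring
    · rw [mul_planeRotation_other _ _ _ _ hj hj', mul_planeRotation_other _ _ _ _ hj hj']
      simp [Ne.symm hj, Ne.symm hj']
  · rw [planeRotation_mul_other _ _ _ _ hil him, hR]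
    by_cases hj : j = l
    · subst hj
      rw [mul_planeRotation_left hlm]
      simp [hil, him]
    by_cases hj' : j = m
    · subst hj'
      rw [mul_planeRotation_right hlm]
      simp [hil, him]
    · rw [mul_planeRotation_other _ _ _ _ hj hj']

/-- The similarity transformation of `A` by a plane rotation. -/
noncomputable def rotate (l m : Fin n) (θ φ : ℝ) (A : Matrix (Fin n) (Fin n) ℂ) :
    Matrix (Fin n) (Fin n) ℂ :=
  (planeRotation l m θ φ)ᴴ * A * planeRotation l m θ φ

lemma isHermitian_rotate (l m : Fin n) (θ φ : ℝ) {A : Matrix (Fin n) (Fin n) ℂ}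
    (hA : A.IsHermitian) : (rotate l m θ φ A).IsHermitian :=
  Matrix.isHermitian_conjTranspose_mul_mul _ hA

lemma frobNorm_rotate {l m : Fin n} (hlm : l ≠ m) (θ φ : ℝ) (A : Matrix (Fin n) (Fin n) ℂ) :
    frobNorm (rotate l m θ φ A) = frobNorm A :=
  frobNorm_conj (planeRotation_unitary hlm θ φ)

/-- A rotation only mixes columns `l` and `m`, so a mask that treats them alike passes through it.
-/
lemma mask_mul_planeRotation {T : Fin n → Fin n → Prop} {l m : Fin n} (hlm : l ≠ m)
    (hT : ∀ x, T x l ↔ T x m) (θ φ : ℝ) (A : Matrix (Fin n) (Fin n) ℂ) :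
    mask T (A * planeRotation l m θ φ) = mask T A * planeRotation l m θ φ := by
  ext i j
  by_cases hj : j = l
  · subst hj
    rw [mul_planeRotation_left hlm]
    simp only [mask_apply, mul_planeRotation_left hlm]
    have := hT i
    by_cases h : T i m <;> simp [h, this]
  by_cases hj' : j = m
  · subst hj'
    rw [mul_planeRotation_right hlm]
    simp only [mask_apply, mul_planeRotation_right hlm]
    have := hT i
    by_cases h : T i j <;> simp [h, this]
  · rw [mul_planeRotation_other _ _ _ _ hj hj']
    simp only [mask_apply, mul_planeRotation_other _ _ _ _ hj hj']

lemma mask_planeRotation_mul {T : Fin n → Fin n → Prop} {l m : Fin n} (hlm : l ≠ m)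
    (hT : ∀ x, T l x ↔ T m x) (θ φ : ℝ) (A : Matrix (Fin n) (Fin n) ℂ) :
    mask T ((planeRotation l m θ φ)ᴴ * A) = (planeRotation l m θ φ)ᴴ * mask T A := by
  ext i j
  by_cases hj : i = l
  · subst hj
    rw [planeRotation_mul_left hlm]
    simp only [mask_apply, planeRotation_mul_left hlm]
    have := hT j
    by_cases h : T m j <;> simp [h, this]
  by_cases hj' : i = m
  · subst hj'
    rw [planeRotation_mul_right hlm]
    simp only [mask_apply, planeRotation_mul_right hlm]
    have := hT j
    by_cases h : T i j <;> simp [h, this]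
  · rw [planeRotation_mul_other _ _ _ _ hj hj']
    simp only [mask_apply, planeRotation_mul_other _ _ _ _ hj hj']

lemma frobNorm_mask_rotate {T : Fin n → Fin n → Prop} {l m : Fin n} (hlm : l ≠ m)
    (hT : ∀ x, T l x ↔ T m x) (hT' : ∀ x, T x l ↔ T x m) (θ φ : ℝ)
    (A : Matrix (Fin n) (Fin n) ℂ) :
    frobNorm (mask T (rotate l m θ φ A)) = frobNorm (mask T A) := by
  rw [rotate, mask_mul_planeRotation hlm hT', mask_planeRotation_mul hlm hT]
  exact frobNorm_rotate hlm θ φ _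

open Classical in
/-- A rotation changes the sum of squares over a set of off-diagonal positions that does not
separate `l` from `m` only through the position `(l, m)`. -/
lemma frobNorm_mask_rotate_sq {T : Fin n → Fin n → Prop} {l m : Fin n} (hlm : l ≠ m)
    (hsymm : ∀ x y, T x y ↔ T y x) (hirr : ∀ x, ¬ T x x)
    (hT : ∀ x, x ≠ l → x ≠ m → (T l x ↔ T m x)) (θ φ : ℝ)
    {A : Matrix (Fin n) (Fin n) ℂ} (hA : A.IsHermitian) :
    frobNorm (mask T (rotate l m θ φ A)) ^ 2 = frobNorm (mask T A) ^ 2 +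
      if T l m then 2 * (‖rotate l m θ φ A l m‖ ^ 2 - ‖A l m‖ ^ 2) else 0 := by
  -- Without the pivot block the mask is symmetric under exchanging `l` and `m`, so its norm is
  -- exactly invariant.
  set T' : Fin n → Fin n → Prop := fun x y => T x y ∧ ¬ ((x = l ∨ x = m) ∧ (y = l ∨ y = m))
    with hT'
  have split : ∀ B : Matrix (Fin n) (Fin n) ℂ, B.IsHermitian →
      frobNorm (mask T B) ^ 2 = frobNorm (mask T' B) ^ 2 + if T l m then 2 * ‖B l m‖ ^ 2 else 0 := by
    intro B hB
    have h : ∀ x y, (if T x y then ‖B x y‖ ^ 2 else 0) = (if T' x y then ‖B x y‖ ^ 2 else 0) +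
        ((if y = m then if x = l then if T l m then ‖B l m‖ ^ 2 else 0 else 0 else 0) +
        (if y = l then if x = m then if T l m then ‖B l m‖ ^ 2 else 0 else 0 else 0)) := by
      intro x y
      by_cases hx : x = l
      · subst hx
        by_cases hy : y = x
        · subst hy; simp [hT', hirr, hlm]
        by_cases hy' : y = m
        · subst hy'; simp [hT', hlm.symm]
        · simp [hT', hy, hy']
      by_cases hx' : x = m
      · subst hx'
        by_cases hy : y = l
        · subst hy; simp [hT', hsymm x y, norm_apply_comm hB x y, hlm]
        by_cases hy' : y = x
        · subst hy'; simp [hT', hirr, hlm.symm]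
        · simp [hT', hy, hy']
      · simp [hT', hx, hx']
    rw [frobNorm_mask_sq, frobNorm_mask_sq,
      Finset.sum_congr rfl fun x _ => Finset.sum_congr rfl fun y _ => h x y]
    simp only [Finset.sum_add_distrib, Finset.sum_ite_eq', Finset.mem_univ, if_true]
    split_ifs <;> ring
  have hl : ∀ x, T' l x ↔ T' m x := by
    intro x
    by_cases h : x = l ∨ x = m
    · simp only [hT', h]
      simp
    · have := hT x (fun h' => h (Or.inl h')) fun h' => h (Or.inr h')
      simp only [hT', h, this]
      simp
  have hs : ∀ x y, T' x y ↔ T' y x := by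
    intro x y
    simp only [hT', hsymm x y]
    tauto
  rw [split _ (isHermitian_rotate l m θ φ hA), split _ hA,
    frobNorm_mask_rotate hlm hl (fun x => by rw [hs x l, hs x m, hl]) θ φ A]
  split_ifs <;> ring

lemma rotate_left_left {l m : Fin n} (hlm : l ≠ m) (θ φ : ℝ) {A : Matrix (Fin n) (Fin n) ℂ}
    (hA : A.IsHermitian) :
    (rotate l m θ φ A l l).re = Real.cos θ ^ 2 * (A l l).re + Real.sin θ ^ 2 * (A m m).re +
      2 * Real.cos θ * Real.sin θ *
        ((A l m).re * Real.cos φ + (A l m).im * Real.sin φ) := by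
  have hll : (A l l).im = 0 := Complex.conj_eq_iff_im.1 (hA.apply l l)
  have hmm : (A m m).im = 0 := Complex.conj_eq_iff_im.1 (hA.apply m m)
  have h1 : (rotSin θ φ).re = Real.cos φ * Real.sin θ := by
    simp [rotSin, Complex.exp_re, -Complex.ofReal_sin]
  have h2 : (rotSin θ φ).im = -(Real.sin φ * Real.sin θ) := by
    simp [rotSin, Complex.exp_im, -Complex.ofReal_sin]
  rw [rotate, mul_planeRotation_left hlm, planeRotation_mul_left hlm, planeRotation_mul_left hlm,
    ← hA.apply m l]
  simp only [Complex.add_re, Complex.add_im, Complex.mul_re, Complex.mul_im, Complex.star_def,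
    Complex.conj_re, Complex.conj_im, Complex.ofReal_re, Complex.ofReal_im, h1, h2, hll, hmm]
  have := Real.sin_sq_add_cos_sq φ
  linear_combination (Real.sin θ ^ 2 * (A m m).re) * this

lemma rotate_right_right {l m : Fin n} (hlm : l ≠ m) (θ φ : ℝ) (A : Matrix (Fin n) (Fin n) ℂ) :
    (rotate l m θ φ A l l).re + (rotate l m θ φ A m m).re = (A l l).re + (A m m).re := by
  have h := cos_sq_add_rotSin θ φ
  rw [← Complex.add_re, ← Complex.add_re, rotate, mul_planeRotation_left hlm,
    planeRotation_mul_left hlm, planeRotation_mul_left hlm, mul_planeRotation_right hlm,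
    planeRotation_mul_right hlm, planeRotation_mul_right hlm]
  congr 1
  linear_combination (A l l + A m m) * h

lemma norm_rotate_left_right_sq {l m : Fin n} (hlm : l ≠ m) (θ φ : ℝ)
    {A : Matrix (Fin n) (Fin n) ℂ} (hA : A.IsHermitian) :
    ‖rotate l m θ φ A l m‖ ^ 2 =
      (((A m m).re - (A l l).re) / 2 * Real.sin (2 * θ) +
        ((A l m).re * Real.cos φ + (A l m).im * Real.sin φ) * Real.cos (2 * θ)) ^ 2 +
      ((A l m).im * Real.cos φ - (A l m).re * Real.sin φ) ^ 2 := by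
  have hll : (A l l).im = 0 := Complex.conj_eq_iff_im.1 (hA.apply l l)
  have hmm : (A m m).im = 0 := Complex.conj_eq_iff_im.1 (hA.apply m m)
  have h1 : (rotSin θ φ).re = Real.cos φ * Real.sin θ := by
    simp [rotSin, Complex.exp_re, -Complex.ofReal_sin]
  have h2 : (rotSin θ φ).im = -(Real.sin φ * Real.sin θ) := by
    simp [rotSin, Complex.exp_im, -Complex.ofReal_sin]
  rw [rotate, mul_planeRotation_right hlm, planeRotation_mul_left hlm, planeRotation_mul_left hlm,
    ← hA.apply m l, ← Complex.normSq_eq_norm_sq, Complex.normSq_apply]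
  simp only [Complex.add_re, Complex.add_im, Complex.mul_re, Complex.mul_im, Complex.star_def,
    Complex.sub_re, Complex.sub_im,
    Complex.conj_re, Complex.conj_im, Complex.ofReal_re, Complex.ofReal_im, h1, h2, hll, hmm,
    Real.sin_two_mul, Real.cos_two_mul']
  have hφ := Real.sin_sq_add_cos_sq φ
  have hθ := Real.sin_sq_add_cos_sq θ
  generalize (A l m).re = x
  generalize (A l m).im = y
  generalize (A l l).re = a
  generalize (A m m).re = b
  generalize Real.sin θ = s at *
  generalize Real.cos θ = c at *
  generalize Real.sin φ = p at *
  generalize Real.cos φ = q at *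
  -- The rotated pivot is `e^{iφ} (F + i v)`, whose squared modulus is `F ^ 2 + v ^ 2`.
  have hF : ∀ X Y F v : ℝ, X = q * F - p * v → Y = p * F + q * v → X * X + Y * Y = F ^ 2 + v ^ 2 := by
    rintro X Y F v rfl rfl
    linear_combination (F ^ 2 + v ^ 2) * hφ
  apply hF
  · linear_combination (p ^ 2 * x - p * q * y) * hθ - c ^ 2 * x * hφ
  · linear_combination (q ^ 2 * y - p * q * x) * hθ - c ^ 2 * y * hφ

/-! ### The effect of inexact line searches. -/

lemma objective_eq {l m : Fin n} (θ φ : ℝ) (A : Matrix (Fin n) (Fin n) ℂ) :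
    objective A l m θ φ = (rotate l m θ φ A l l).re := by
  rw [objective, rotate, Matrix.mul_assoc]
  simp only [Matrix.mul_apply, dotProduct, Matrix.mulVec, Matrix.conjTranspose_apply, Pi.star_apply]

lemma exists_cos_sin (x y : ℝ) : ∃ ψ ∈ Set.Icc (-Real.pi) Real.pi,
    Real.sqrt (x ^ 2 + y ^ 2) = x * Real.cos ψ + y * Real.sin ψ := by
  refine ⟨Complex.arg ⟨x, y⟩, ⟨(Complex.neg_pi_lt_arg _).le, Complex.arg_le_pi _⟩, ?_⟩
  have h1 := Complex.norm_mul_cos_arg ⟨x, y⟩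
  have h2 := Complex.norm_mul_sin_arg ⟨x, y⟩
  have h3 : ‖(⟨x, y⟩ : ℂ)‖ = Real.sqrt (x ^ 2 + y ^ 2) := by
    rw [Complex.norm_def, Complex.normSq_apply]
    ring_nf
  rw [h3] at h1 h2
  simp only at h1 h2
  set r := Real.sqrt (x ^ 2 + y ^ 2)
  have := Real.sin_sq_add_cos_sq (Complex.arg ⟨x, y⟩)
  linear_combination (-r) * this + Real.cos (Complex.arg ⟨x, y⟩) * h1 +
    Real.sin (Complex.arg ⟨x, y⟩) * h2

/-- Over a full period the minimum is `-√(x ^ 2 + y ^ 2)`; attaining it leaves no room for the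
orthogonal component. No derivative is needed, so minimizers at the ends of the interval are
covered. -/
lemma eq_zero_of_isMinOn_linear {x y t : ℝ}
    (h : ∀ s ∈ Set.Icc (-Real.pi) Real.pi,
      x * Real.cos t + y * Real.sin t ≤ x * Real.cos s + y * Real.sin s) :
    y * Real.cos t - x * Real.sin t = 0 := by
  obtain ⟨s, hs, he⟩ := exists_cos_sin (-x) (-y)
  have h1 := h s hs
  have h0 : 0 ≤ x ^ 2 + y ^ 2 := by positivity
  have h2 : Real.sqrt (x ^ 2 + y ^ 2) ≤ -(x * Real.cos t + y * Real.sin t) := by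
    rw [neg_sq, neg_sq] at he
    linarith
  have h3 := pow_le_pow_left₀ (Real.sqrt_nonneg _) h2 2
  rw [Real.sq_sqrt h0] at h3
  have h4 := Real.sin_sq_add_cos_sq t
  refine pow_eq_zero_iff (two_ne_zero) |>.1 (le_antisymm ?_ (sq_nonneg _))
  have : (y * Real.cos t - x * Real.sin t) ^ 2 + (-(x * Real.cos t + y * Real.sin t)) ^ 2 =
      x ^ 2 + y ^ 2 := by linear_combination (x ^ 2 + y ^ 2) * h4
  linarith

lemma foldAngle_spec {α β t : ℝ} (ht : t ∈ Set.Icc (-(Real.pi / 2)) (Real.pi / 2))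
    (h : α * Real.sin (2 * t) + β * Real.cos (2 * t) = 0) :
    |foldAngle t| ≤ Real.pi / 4 ∧
      α * Real.sin (2 * foldAngle t) + β * Real.cos (2 * foldAngle t) = 0 := by
  obtain ⟨h1, h2⟩ := ht
  have hπ := Real.pi_pos
  rw [foldAngle, abs_le]
  split_ifs with h3 h4
  · exact ⟨⟨h3.1, h3.2⟩, h⟩
  · have h5 : Real.pi / 4 < t := by
      by_contra hc
      exact h3 ⟨by linarith, not_lt.1 hc⟩
    refine ⟨⟨by linarith, by linarith⟩, ?_⟩
    rw [show 2 * (t - 1 * (Real.pi / 2)) = 2 * t - Real.pi by ring, Real.sin_sub_pi,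
      Real.cos_sub_pi]
    linarith
  · have h5 : t < -(Real.pi / 4) := by
      by_contra hc
      exact h3 ⟨not_lt.1 hc, by linarith⟩
    refine ⟨⟨by linarith, by linarith⟩, ?_⟩
    rw [show 2 * (t - (-1) * (Real.pi / 2)) = 2 * t + Real.pi by ring, Real.sin_add_pi,
      Real.cos_add_pi]
    linarith

/-- The exact line search along `θ` for the angle `φ` found: its folded minimizer `t` satisfies the
stationarity condition, and the pivot phase is within the accuracy of the optimal one. -/
lemma exists_exact_angle {η : ℝ} {A : Matrix (Fin n) (Fin n) ℂ} (hA : A.IsHermitian) {l m : Fin n}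
    (hlm : l ≠ m) {θ φ : ℝ} (h : LineSearchOutcome η A l m θ φ) :
    |(A l m).im * Real.cos φ - (A l m).re * Real.sin φ| ≤ η * ‖A l m‖ ∧
    ∃ t, |t| ≤ Real.pi / 4 ∧ |θ - t| ≤ η ∧
      ((A m m).re - (A l l).re) / 2 * Real.sin (2 * t) +
        ((A l m).re * Real.cos φ + (A l m).im * Real.sin φ) * Real.cos (2 * t) = 0 := by
  obtain ⟨⟨ψ, hψ, hmin, hd⟩, t, ht, hmin', hd'⟩ := h
  constructor
  · have h0 : (A l m).im * Real.cos ψ - (A l m).re * Real.sin ψ = 0 := by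
      refine eq_zero_of_isMinOn_linear fun s hs => ?_
      have := isMinOn_iff.1 hmin s hs
      simp only [objective_eq, rotate_left_left hlm _ _ hA, Real.cos_pi_div_four,
        Real.sin_pi_div_four] at this
      have h2 : Real.sqrt 2 ^ 2 = 2 := Real.sq_sqrt (by norm_num)
      nlinarith
    have hn : ‖A l m‖ ^ 2 = (A l m).re ^ 2 + (A l m).im ^ 2 := by
      rw [← Complex.normSq_eq_norm_sq, Complex.normSq_apply]; ring
    set x := (A l m).re
    set y := (A l m).im
    have hφ : φ = ψ + (φ - ψ) := by ring
    have e1 : y * Real.cos φ - x * Real.sin φ =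
        -(x * Real.cos ψ + y * Real.sin ψ) * Real.sin (φ - ψ) := by
      rw [hφ, Real.cos_add, Real.sin_add, ← hφ]
      linear_combination Real.cos (φ - ψ) * h0
    have e2 : |-(x * Real.cos ψ + y * Real.sin ψ)| ≤ ‖A l m‖ := by
      refine abs_le_of_sq_le_sq ?_ (norm_nonneg _)
      rw [hn]
      have := Real.sin_sq_add_cos_sq ψ
      nlinarith [sq_nonneg (y * Real.cos ψ - x * Real.sin ψ)]
    rw [e1, abs_mul, mul_comm η]
    exact mul_le_mul e2 (Real.abs_sin_le_abs.trans hd) (abs_nonneg _) (norm_nonneg _)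
  · have hf : ((A m m).re - (A l l).re) / 2 * Real.sin (2 * t) +
        ((A l m).re * Real.cos φ + (A l m).im * Real.sin φ) * Real.cos (2 * t) = 0 := by
      -- In the doubled angle the objective is a constant plus a linear form in cosine and sine, and
      -- `2 * t` runs through a full period.
      have := eq_zero_of_isMinOn_linear (x := -(((A m m).re - (A l l).re) / 2))
        (y := (A l m).re * Real.cos φ + (A l m).im * Real.sin φ) (t := 2 * t) fun s hs => ?_
      · linarith
      have h1 := isMinOn_iff.1 hmin' (s / 2)
        ⟨by linarith [hs.1, hs.2], by linarith [hs.1, hs.2]⟩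
      simp only [objective_eq, rotate_left_left hlm _ _ hA] at h1
      have h2 : s = 2 * (s / 2) := by ring
      rw [h2, Real.cos_two_mul', Real.sin_two_mul, Real.cos_two_mul', Real.sin_two_mul]
      have h3 := Real.sin_sq_add_cos_sq t
      have h4 := Real.sin_sq_add_cos_sq (s / 2)
      linear_combination h1 + ((A m m).re + (A l l).re) / 2 * (h4 - h3)
    obtain ⟨h1, h2⟩ := foldAngle_spec ht hf
    exact ⟨foldAngle t, h1, hd', h2⟩

/-- Stationarity at `t` turns the first component of the new pivot into an amplitude times `sin (2 *
(θ - t))`; the second component is the phase error. Both are of order `η`. -/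
lemma norm_rotate_pivot_sq_le {η : ℝ} {A : Matrix (Fin n) (Fin n) ℂ}
    (hA : A.IsHermitian) {l m : Fin n} (hlm : l ≠ m) {θ φ : ℝ}
    (h : LineSearchOutcome η A l m θ φ) :
    ‖rotate l m θ φ A l m‖ ^ 2 ≤ 5 / 2 * η ^ 2 * frobNorm A ^ 2 := by
  obtain ⟨hv, t, -, hd, hf⟩ := exists_exact_angle hA hlm h
  rw [norm_rotate_left_right_sq hlm _ _ hA]
  have hb := block_le_frobNorm_sq hA hlm
  have hn : ‖A l m‖ ^ 2 = ((A l m).re * Real.cos φ + (A l m).im * Real.sin φ) ^ 2 +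
      ((A l m).im * Real.cos φ - (A l m).re * Real.sin φ) ^ 2 := by
    rw [← Complex.normSq_eq_norm_sq, Complex.normSq_apply]
    have := Real.sin_sq_add_cos_sq φ
    linear_combination (-((A l m).re ^ 2 + (A l m).im ^ 2)) * this
  have ha := pow_le_pow_left₀ (abs_nonneg _) (Complex.abs_re_le_norm (A l l)) 2
  have hb' := pow_le_pow_left₀ (abs_nonneg _) (Complex.abs_re_le_norm (A m m)) 2
  rw [sq_abs] at ha hb'
  set u := (A l m).re * Real.cos φ + (A l m).im * Real.sin φ
  set v := (A l m).im * Real.cos φ - (A l m).re * Real.sin φ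
  set a := (A l l).re
  set b := (A m m).re
  have hv' := pow_le_pow_left₀ (abs_nonneg _) hv 2
  rw [sq_abs, mul_pow] at hv'
  have hθ : 2 * θ = 2 * t + 2 * (θ - t) := by ring
  have e1 : (b - a) / 2 * Real.sin (2 * θ) + u * Real.cos (2 * θ) =
      Real.sin (2 * (θ - t)) * ((b - a) / 2 * Real.cos (2 * t) - u * Real.sin (2 * t)) := by
    rw [hθ, Real.sin_add, Real.cos_add]
    linear_combination Real.cos (2 * (θ - t)) * hf
  have e2 : ((b - a) / 2 * Real.cos (2 * t) - u * Real.sin (2 * t)) ^ 2 =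
      ((b - a) / 2) ^ 2 + u ^ 2 := by
    have := Real.sin_sq_add_cos_sq (2 * t)
    linear_combination (((b - a) / 2) ^ 2 + u ^ 2) * this -
      ((b - a) / 2 * Real.sin (2 * t) + u * Real.cos (2 * t)) * hf
  have e3 : Real.sin (2 * (θ - t)) ^ 2 ≤ 4 * η ^ 2 := by
    have h1 : |Real.sin (2 * (θ - t))| ≤ 2 * η := by
      refine Real.abs_sin_le_abs.trans ?_
      rw [abs_mul, abs_two]
      linarith
    have := pow_le_pow_left₀ (abs_nonneg _) h1 2
    rw [sq_abs] at this
    linarith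
  rw [e1, mul_pow, e2]
  have e4 := mul_le_mul_of_nonneg_right e3 (show 0 ≤ ((b - a) / 2) ^ 2 + u ^ 2 by positivity)
  have e5 : 4 * (((b - a) / 2) ^ 2 + u ^ 2) + ‖A l m‖ ^ 2 ≤ 5 / 2 * frobNorm A ^ 2 := by
    nlinarith [sq_nonneg (a + b), sq_nonneg v]
  nlinarith [mul_le_mul_of_nonneg_left e5 (sq_nonneg η)]

/-- With the exact angle the entry moves by `u * tan t`, and folding to `|t| ≤ π / 4` gives `|tan t|
≤ 1`. The angle error contributes the term with `η`. -/
lemma abs_rotate_diag_sub_le {η : ℝ} {A : Matrix (Fin n) (Fin n) ℂ}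
    (hA : A.IsHermitian) {l m : Fin n} (hlm : l ≠ m) {θ φ : ℝ}
    (h : LineSearchOutcome η A l m θ φ) (i : Fin n) :
    |(rotate l m θ φ A i i).re - (A i i).re| ≤ offNorm A + 2 * η * frobNorm A := by
  obtain ⟨hv, t, htt, hd, hf⟩ := exists_exact_angle hA hlm h
  have hη : 0 ≤ η := (abs_nonneg _).trans hd
  have hz := norm_apply_le_offNorm hA hlm
  suffices hl : |(rotate l m θ φ A l l).re - (A l l).re| ≤ offNorm A + 2 * η * frobNorm A by
    by_cases h1 : i = l
    · rwa [h1]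
    by_cases h2 : i = m
    · rw [h2]
      rw [abs_sub_comm] at hl
      convert hl using 2
      linarith [rotate_right_right hlm θ φ A]
    · rw [rotate, mul_planeRotation_other _ _ _ _ h1 h2, planeRotation_mul_other _ _ _ _ h1 h2]
      simp only [sub_self, abs_zero]
      have := frobNorm_nonneg A
      have := offNorm_nonneg A
      positivity
  have hb := block_le_frobNorm_sq hA hlm
  have hn : ‖A l m‖ ^ 2 = ((A l m).re * Real.cos φ + (A l m).im * Real.sin φ) ^ 2 +
      ((A l m).im * Real.cos φ - (A l m).re * Real.sin φ) ^ 2 := by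
    rw [← Complex.normSq_eq_norm_sq, Complex.normSq_apply]
    have := Real.sin_sq_add_cos_sq φ
    linear_combination (-((A l m).re ^ 2 + (A l m).im ^ 2)) * this
  rw [rotate_left_left hlm _ _ hA]
  have ha := pow_le_pow_left₀ (abs_nonneg _) (Complex.abs_re_le_norm (A l l)) 2
  have hb' := pow_le_pow_left₀ (abs_nonneg _) (Complex.abs_re_le_norm (A m m)) 2
  rw [sq_abs] at ha hb'
  set u := (A l m).re * Real.cos φ + (A l m).im * Real.sin φ
  set v := (A l m).im * Real.cos φ - (A l m).re * Real.sin φ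
  set a := (A l l).re
  set b := (A m m).re
  set g := (b - a) / 2 * Real.cos (2 * t) - u * Real.sin (2 * t)
  have hu : |u| ≤ ‖A l m‖ := abs_le_of_sq_le_sq (by nlinarith) (norm_nonneg _)
  have e2 : g ^ 2 = ((b - a) / 2) ^ 2 + u ^ 2 := by
    have := Real.sin_sq_add_cos_sq (2 * t)
    linear_combination (((b - a) / 2) ^ 2 + u ^ 2) * this -
      ((b - a) / 2 * Real.sin (2 * t) + u * Real.cos (2 * t)) * hf
  have hg : |g| ≤ frobNorm A := by
    refine abs_le_of_sq_le_sq ?_ (frobNorm_nonneg A)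
    nlinarith [sq_nonneg (a + b), sq_nonneg v]
  have hπ := Real.pi_pos
  obtain ⟨ht1, ht2⟩ := abs_le.1 htt
  have hc : 0 < Real.cos t := Real.cos_pos_of_mem_Ioo ⟨by linarith, by linarith⟩
  have hc2 : 0 ≤ Real.cos (2 * t) := Real.cos_nonneg_of_mem_Icc ⟨by linarith, by linarith⟩
  have hsc : |Real.sin t| ≤ Real.cos t := by
    refine abs_le_of_sq_le_sq ?_ hc.le
    rw [Real.cos_two_mul'] at hc2
    linarith
  have e3 : ((b - a) / 2 - g) * Real.cos t = u * Real.sin t := by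
    simp only [g, Real.cos_two_mul', Real.sin_two_mul] at hf ⊢
    have := Real.sin_sq_add_cos_sq t
    linear_combination Real.sin t * hf + (u * Real.sin t - (b - a) / 2 * Real.cos t) * this
  have e4 : |(b - a) / 2 - g| ≤ |u| := by
    refine le_of_mul_le_mul_right ?_ hc
    calc |(b - a) / 2 - g| * Real.cos t = |u| * |Real.sin t| := by
          rw [← abs_mul, ← e3, abs_mul, abs_of_pos hc]
      _ ≤ _ := mul_le_mul_of_nonneg_left hsc (abs_nonneg _)
  have e5 : Real.cos θ ^ 2 * a + Real.sin θ ^ 2 * b + 2 * Real.cos θ * Real.sin θ * u - a =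
      ((b - a) / 2 - g) + g * (1 - Real.cos (2 * (θ - t))) := by
    have h1 : Real.cos θ ^ 2 * a + Real.sin θ ^ 2 * b + 2 * Real.cos θ * Real.sin θ * u =
        (a + b) / 2 - (b - a) / 2 * Real.cos (2 * t + 2 * (θ - t)) +
          u * Real.sin (2 * t + 2 * (θ - t)) := by
      have hθ : 2 * t + 2 * (θ - t) = 2 * θ := by ring
      have := Real.sin_sq_add_cos_sq θ
      rw [hθ, Real.cos_two_mul', Real.sin_two_mul]
      linear_combination (a + b) / 2 * this
    rw [h1, Real.cos_add, Real.sin_add]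
    linear_combination Real.sin (2 * (θ - t)) * hf
  have e6 : |1 - Real.cos (2 * (θ - t))| ≤ 2 * η := by
    rw [abs_of_nonneg (by linarith [Real.cos_le_one (2 * (θ - t))])]
    have := Real.abs_sin_le_abs (x := θ - t)
    have h1 : |Real.sin (θ - t)| ≤ 1 := Real.abs_sin_le_one _
    have h2 : Real.sin (θ - t) ^ 2 = |Real.sin (θ - t)| ^ 2 := (sq_abs _).symm
    rw [Real.cos_two_mul']
    have := Real.sin_sq_add_cos_sq (θ - t)
    have h3 : |Real.sin (θ - t)| ^ 2 ≤ |Real.sin (θ - t)| := by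
      rw [sq]
      exact mul_le_of_le_one_left (abs_nonneg _) h1
    linarith
  rw [e5]
  refine (abs_add_le _ _).trans ?_
  rw [abs_mul]
  have := mul_le_mul hg e6 (abs_nonneg _) (frobNorm_nonneg A)
  linarith

/-- Stationarity reads `(a - b) / 2 * sin (2 * t) = u * cos (2 * t)`, so a wide diagonal gap forces
a small `sin (2 * t)`; folding excludes `t` near `±π / 2`. -/
lemma angle_small {η δ : ℝ} {A : Matrix (Fin n) (Fin n) ℂ}
    (hA : A.IsHermitian) {l m : Fin n} (hlm : l ≠ m) {θ φ : ℝ}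
    (h : LineSearchOutcome η A l m θ φ) (hδ : 0 < δ)
    (hgap : 2 * δ ≤ |(A l l).re - (A m m).re|) :
    |Real.sin θ| ≤ offNorm A / δ + η ∧ |Real.cos θ - 1| ≤ offNorm A / δ + η := by
  obtain ⟨hv, t, htt, hd, hf⟩ := exists_exact_angle hA hlm h
  have hz := norm_apply_le_offNorm hA hlm
  have hn : ‖A l m‖ ^ 2 = ((A l m).re * Real.cos φ + (A l m).im * Real.sin φ) ^ 2 +
      ((A l m).im * Real.cos φ - (A l m).re * Real.sin φ) ^ 2 := by
    rw [← Complex.normSq_eq_norm_sq, Complex.normSq_apply]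
    have := Real.sin_sq_add_cos_sq φ
    linear_combination (-((A l m).re ^ 2 + (A l m).im ^ 2)) * this
  set u := (A l m).re * Real.cos φ + (A l m).im * Real.sin φ
  set v := (A l m).im * Real.cos φ - (A l m).re * Real.sin φ
  set a := (A l l).re
  set b := (A m m).re
  have hu : |u| ≤ offNorm A := (abs_le_of_sq_le_sq (by nlinarith) (norm_nonneg _)).trans hz
  have hπ := Real.pi_pos
  obtain ⟨ht1, ht2⟩ := abs_le.1 htt
  have hc : 1 / 2 ≤ Real.cos t := by
    rw [← Real.cos_pi_div_three, ← Real.cos_abs t]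
    exact Real.cos_le_cos_of_nonneg_of_le_pi (abs_nonneg _) (by linarith) (by linarith)
  have e1 : |Real.sin (2 * t)| ≤ offNorm A / δ := by
    rw [le_div_iff₀ hδ]
    have h1 : (a - b) / 2 * Real.sin (2 * t) = u * Real.cos (2 * t) := by linarith
    have h2 : |a - b| / 2 * |Real.sin (2 * t)| = |u| * |Real.cos (2 * t)| := by
      rw [← abs_mul, ← h1, abs_mul, abs_div, abs_two]
    have h3 := Real.abs_cos_le_one (2 * t)
    nlinarith [abs_nonneg (Real.sin (2 * t)), abs_nonneg u]
  have e2 : |Real.sin t| ≤ |Real.sin (2 * t)| := by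
    rw [Real.sin_two_mul, abs_mul, abs_mul, abs_two, abs_of_nonneg (by linarith : 0 ≤ Real.cos t)]
    nlinarith [abs_nonneg (Real.sin t)]
  have e3 : |Real.cos t - 1| ≤ |Real.sin t| := by
    have h1 := Real.cos_le_one t
    have h2 := Real.sin_sq_add_cos_sq t
    have h3 := Real.abs_sin_le_one t
    rw [abs_of_nonpos (by linarith)]
    have := sq_abs (Real.sin t)
    nlinarith [abs_nonneg (Real.sin t)]
  have e4 : |Real.sin θ - Real.sin t| ≤ |θ - t| := Real.abs_sin_sub_sin_le θ t
  have e5 : |Real.cos θ - Real.cos t| ≤ |θ - t| := Real.abs_cos_sub_cos_le θ t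
  constructor
  · have := abs_add_le (Real.sin θ - Real.sin t) (Real.sin t)
    rw [sub_add_cancel] at this
    linarith
  · have := abs_add_le (Real.cos θ - Real.cos t) (Real.cos t - 1)
    rw [sub_add_sub_cancel] at this
    linarith

/-! ### Spectral weights and eigenvalue localization. -/

/-- `A` is unitarily similar to the real diagonal matrix with the entries `ev`. -/
def SpectralForm (A : Matrix (Fin n) (Fin n) ℂ) (ev : Fin n → ℝ) : Prop :=
  ∃ V : Matrix (Fin n) (Fin n) ℂ, V * Vᴴ = 1 ∧
    A = V * Matrix.diagonal (fun l => (ev l : ℂ)) * Vᴴ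

lemma conj_diagonal_apply (V : Matrix (Fin n) (Fin n) ℂ) (f : Fin n → ℂ) (i j : Fin n) :
    (V * Matrix.diagonal f * Vᴴ) i j = ∑ l, f l * (V i l * star (V j l)) := by
  rw [Matrix.mul_apply]
  refine Finset.sum_congr rfl fun l _ => ?_
  rw [Matrix.mul_diagonal, Matrix.conjTranspose_apply]
  ring

lemma spectralForm_eigenvalues {G : Matrix (Fin n) (Fin n) ℂ} (hG : G.IsHermitian) :
    SpectralForm G hG.eigenvalues := by
  refine ⟨hG.eigenvectorUnitary, ?_, ?_⟩
  · exact (Matrix.mem_unitaryGroup_iff).1 hG.eigenvectorUnitary.2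
  · have h := hG.spectral_theorem
    rw [Unitary.conjStarAlgAut_apply] at h
    exact h

namespace SpectralForm

variable {A : Matrix (Fin n) (Fin n) ℂ} {ev : Fin n → ℝ}

lemma isHermitian (h : SpectralForm A ev) : A.IsHermitian := by
  obtain ⟨V, -, rfl⟩ := h
  refine Matrix.isHermitian_mul_mul_conjTranspose _ ?_
  rw [Matrix.IsHermitian, Matrix.diagonal_conjTranspose]
  congr 1
  ext l
  simp

lemma frobNorm_eq (h : SpectralForm A ev) :
    frobNorm A = frobNorm (Matrix.diagonal (fun l => (ev l : ℂ))) := by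
  obtain ⟨V, hV, rfl⟩ := h
  have := frobNorm_conj (A := Matrix.diagonal (fun l => (ev l : ℂ))) (R := Vᴴ)
    (by rw [Matrix.conjTranspose_conjTranspose]; exact mul_eq_one_comm.1 hV)
  rwa [Matrix.conjTranspose_conjTranspose] at this

lemma conj (h : SpectralForm A ev) {R : Matrix (Fin n) (Fin n) ℂ} (hR : R * Rᴴ = 1) :
    SpectralForm (Rᴴ * A * R) ev := by
  obtain ⟨V, hV, rfl⟩ := h
  have hR' := mul_eq_one_comm.1 hR
  refine ⟨Rᴴ * V, ?_, ?_⟩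
  · rw [Matrix.conjTranspose_mul, Matrix.conjTranspose_conjTranspose, Matrix.mul_assoc,
      ← Matrix.mul_assoc V, hV, Matrix.one_mul, hR']
  · simp only [Matrix.conjTranspose_mul, Matrix.conjTranspose_conjTranspose, Matrix.mul_assoc]

lemma rotate (h : SpectralForm A ev) {l m : Fin n} (hlm : l ≠ m) (θ φ : ℝ) :
    SpectralForm (rotate l m θ φ A) ev :=
  h.conj (planeRotation_unitary hlm θ φ)

lemma submatrix (h : SpectralForm A ev) (σ : Equiv.Perm (Fin n)) :
    SpectralForm (A.submatrix σ σ) ev := by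
  obtain ⟨V, hV, rfl⟩ := h
  refine ⟨V.submatrix σ id, ?_, ?_⟩
  · ext i j
    have := congrFun (congrFun hV (σ i)) (σ j)
    simpa [Matrix.mul_apply, Matrix.one_apply] using this
  · ext i j
    rw [Matrix.submatrix_apply, conj_diagonal_apply, conj_diagonal_apply]
    rfl

/-- The distance of the `i`th row of `A` from that of `x • 1`, in terms of the eigenvalues. -/
lemma exists_weights (h : SpectralForm A ev) : ∃ V : Matrix (Fin n) (Fin n) ℂ,
    (∀ i, ∑ l, ‖V i l‖ ^ 2 = 1) ∧
    (∀ (x : ℝ) i, ∑ l, (ev l - x) ^ 2 * ‖V i l‖ ^ 2 =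
      (∑ j, if j ≠ i then ‖A i j‖ ^ 2 else 0) + ((A i i).re - x) ^ 2) ∧
    ∀ (x : ℝ) i j, i ≠ j → A i j = ∑ l, ((ev l - x : ℝ) : ℂ) * (V i l * star (V j l)) := by
  have hA := h.isHermitian
  obtain ⟨V, hV, hAV⟩ := h
  have hVV : ∀ i j, ∑ l, V i l * star (V j l) = (1 : Matrix (Fin n) (Fin n) ℂ) i j := by
    intro i j
    rw [← hV, Matrix.mul_apply]
    rfl
  have hns : ∀ z : ℂ, z * star z = ((‖z‖ ^ 2 : ℝ) : ℂ) := fun z => by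
    rw [Complex.star_def, Complex.mul_conj, Complex.normSq_eq_norm_sq]
  have hshift : ∀ x : ℝ, A - (x : ℂ) • (1 : Matrix (Fin n) (Fin n) ℂ) =
      V * Matrix.diagonal (fun l => ((ev l - x : ℝ) : ℂ)) * Vᴴ := by
    intro x
    ext i j
    rw [Matrix.sub_apply, Matrix.smul_apply, ← hVV, hAV, conj_diagonal_apply,
      conj_diagonal_apply, Finset.smul_sum, ← Finset.sum_sub_distrib]
    refine Finset.sum_congr rfl fun l _ => ?_
    rw [smul_eq_mul]
    push_cast
    ring
  refine ⟨V, fun i => ?_, fun x i => ?_, fun x i j hij => ?_⟩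
  · have := hVV i i
    simp only [hns, Matrix.one_apply_eq] at this
    exact_mod_cast this
  -- The squared norm of the `i`th row is the `i`th diagonal entry of `B * Bᴴ`.
  · set B := A - (x : ℂ) • (1 : Matrix (Fin n) (Fin n) ℂ) with hB
    have h1 : B * Bᴴ = V * Matrix.diagonal (fun l => (((ev l - x) ^ 2 : ℝ) : ℂ)) * Vᴴ := by
      have h2 : Vᴴ * V = 1 := mul_eq_one_comm.1 hV
      have h3 : (Matrix.diagonal (fun l => ((ev l - x : ℝ) : ℂ)))ᴴ =
          Matrix.diagonal (fun l => ((ev l - x : ℝ) : ℂ)) := by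
        rw [Matrix.diagonal_conjTranspose]
        congr 1
        ext l
        exact Complex.conj_ofReal _
      rw [hB, hshift, Matrix.conjTranspose_mul, Matrix.conjTranspose_mul,
        Matrix.conjTranspose_conjTranspose, h3]
      have h4 : ∀ D : Matrix (Fin n) (Fin n) ℂ, V * D * Vᴴ * (V * (D * Vᴴ)) =
          V * (D * (Vᴴ * V) * D) * Vᴴ := fun D => by simp only [Matrix.mul_assoc]
      rw [h4, h2, Matrix.mul_one, Matrix.diagonal_mul_diagonal]
      congr 3
      ext l
      push_cast
      ring
    have h5 := congrFun (congrFun h1 i) i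
    rw [conj_diagonal_apply, Matrix.mul_apply] at h5
    simp only [Matrix.conjTranspose_apply, hns] at h5
    have h6 : ∑ j, ‖B i j‖ ^ 2 = ∑ l, (ev l - x) ^ 2 * ‖V i l‖ ^ 2 := by exact_mod_cast h5
    rw [← h6]
    have h7 : ∀ j, ‖B i j‖ ^ 2 = (if j ≠ i then ‖A i j‖ ^ 2 else 0) +
        if j = i then ((A i i).re - x) ^ 2 else 0 := by
      intro j
      by_cases hj : j = i
      · subst hj
        have him : (A j j).im = 0 := Complex.conj_eq_iff_im.1 (hA.apply j j)
        rw [← Complex.normSq_eq_norm_sq, Complex.normSq_apply]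
        simp [hB, him]
        ring
      · simp [hB, hj, Matrix.one_apply_ne (Ne.symm hj)]
    rw [Finset.sum_congr rfl fun j _ => h7 j, Finset.sum_add_distrib]
    simp
  · rw [← conj_diagonal_apply, ← hshift]
    simp [hij]

/-- The weighted mean square distance of the eigenvalues from `A i i` is the off-diagonal row sum,
at most `offNorm A ^ 2`, so not every distance can exceed `offNorm A`. -/
lemma exists_eigenvalue_near (h : SpectralForm A ev) (i : Fin n) :
    ∃ l, |(A i i).re - ev l| ≤ offNorm A := by
  obtain ⟨V, h1, h2, -⟩ := h.exists_weights
  by_contra hc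
  push Not at hc
  have h3 := h2 (A i i).re i
  have h4 := sum_row_le_offNorm_sq h.isHermitian i
  have h5 : ∑ l, offNorm A ^ 2 * ‖V i l‖ ^ 2 < ∑ l, (ev l - (A i i).re) ^ 2 * ‖V i l‖ ^ 2 := by
    have hlt : ∀ l, offNorm A ^ 2 < (ev l - (A i i).re) ^ 2 := fun l => by
      have := pow_lt_pow_left₀ (hc l) (offNorm_nonneg A) two_ne_zero
      rw [sq_abs] at this
      linarith
    refine Finset.sum_lt_sum (fun l _ => mul_le_mul_of_nonneg_right (hlt l).le (sq_nonneg _)) ?_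
    by_contra hz
    push Not at hz
    have : ∀ l, ‖V i l‖ ^ 2 = 0 := fun l => by
      have := hz l (Finset.mem_univ l)
      nlinarith [hlt l, sq_nonneg ‖V i l‖]
    have h6 := h1 i
    simp only [this, Finset.sum_const_zero] at h6
    exact zero_ne_one h6
  rw [← Finset.mul_sum, h1 i, h3, sub_self] at h5
  linarith

end SpectralForm

/-! ### Eigenvalue clusters. -/

/-- The numbers `ev` lie within `s` of the centres `μ`, and distinct centres are separated by
`3 * δ`. -/
structure Clustered (ev μ : Fin n → ℝ) (s δ : ℝ) : Prop where
  pos : 0 < δ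
  nonneg : 0 ≤ s
  small : 16 * s ≤ δ
  near : ∀ l, |ev l - μ l| ≤ s
  sep : ∀ l r, μ l ≠ μ r → 3 * δ ≤ |μ l - μ r|

namespace Clustered

variable {A : Matrix (Fin n) (Fin n) ℂ} {ev μ : Fin n → ℝ} {s δ : ℝ}

lemma eq_of_near (h : Clustered ev μ s δ) {x y u v : ℝ} (hx : x ∈ Set.range μ)
    (hy : y ∈ Set.range μ) (hu : |u - x| + |v - y| + |u - v| < 3 * δ) : x = y := by
  obtain ⟨l, rfl⟩ := hx
  obtain ⟨r, rfl⟩ := hy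
  by_contra hne
  have h1 := h.sep l r hne
  have h2 : |μ l - μ r| ≤ |u - μ l| + |v - μ r| + |u - v| := by
    have e : μ l - μ r = -(u - μ l) + ((v - μ r) + (u - v)) := by ring
    rw [e]
    refine (abs_add_le _ _).trans ?_
    rw [abs_neg]
    linarith [abs_add_le (v - μ r) (u - v)]
  linarith

lemma exists_center_near (h : Clustered ev μ s δ) (hA : SpectralForm A ev) (i : Fin n) :
    ∃ x ∈ Set.range μ, |(A i i).re - x| ≤ offNorm A + s := by
  obtain ⟨l, hl⟩ := hA.exists_eigenvalue_near i
  refine ⟨μ l, ⟨l, rfl⟩, ?_⟩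
  have := abs_add_le ((A i i).re - ev l) (ev l - μ l)
  rw [sub_add_sub_cancel] at this
  linarith [h.near l]

/-- Off-diagonal entries between two indices of the same cluster are of second order. -/
lemma norm_apply_le (h : Clustered ev μ s δ) (hA : SpectralForm A ev) {i j : Fin n} (hij : i ≠ j)
    {x Q : ℝ} (hx : x ∈ Set.range μ) (hP : offNorm A ≤ Q) (hi : |(A i i).re - x| ≤ Q)
    (hj : |(A j j).re - x| ≤ Q) : ‖A i j‖ ≤ s + Q ^ 2 / δ := by
  obtain ⟨r, rfl⟩ := hx
  have hδ := h.pos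
  obtain ⟨V, h1, h2, h3⟩ := hA.exists_weights
  have hρ : ∀ i, |(A i i).re - μ r| ≤ Q → ∑ l, (ev l - μ r) ^ 2 * ‖V i l‖ ^ 2 ≤ 2 * Q ^ 2 := by
    intro i hi
    rw [h2]
    have e1 := sum_row_le_offNorm_sq hA.isHermitian i
    have e2 := pow_le_pow_left₀ (offNorm_nonneg A) hP 2
    have e3 := pow_le_pow_left₀ (abs_nonneg _) hi 2
    rw [sq_abs] at e3
    linarith
  -- Eigenvalues of the cluster contribute `s`. The others are at least `2 * δ` away, so their
  -- distance is at most its square over `2 * δ`, and the weighted squares are controlled by `hρ`.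
  have hb : ∀ l, |ev l - μ r| ≤ s + (ev l - μ r) ^ 2 / (2 * δ) := by
    intro l
    have hn := h.near l
    by_cases hl : μ l = μ r
    · rw [hl] at hn
      have : 0 ≤ (ev l - μ r) ^ 2 / (2 * δ) := by positivity
      linarith
    · have e1 := h.sep l r hl
      have e2 := abs_add_le (μ l - ev l) (ev l - μ r)
      rw [sub_add_sub_cancel, abs_sub_comm (μ l) (ev l)] at e2
      have e3 : 2 * δ ≤ |ev l - μ r| := by linarith [h.small, h.nonneg]
      have e4 : |ev l - μ r| ≤ (ev l - μ r) ^ 2 / (2 * δ) := by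
        rw [le_div_iff₀ (by positivity), ← sq_abs, sq]
        exact mul_le_mul_of_nonneg_left e3 (abs_nonneg _)
      linarith [h.nonneg]
  have e1 : ∀ l, ‖((ev l - μ r : ℝ) : ℂ) * (V i l * star (V j l))‖ ≤
      s / 2 * ‖V i l‖ ^ 2 + s / 2 * ‖V j l‖ ^ 2 +
      (1 / (4 * δ) * ((ev l - μ r) ^ 2 * ‖V i l‖ ^ 2) +
        1 / (4 * δ) * ((ev l - μ r) ^ 2 * ‖V j l‖ ^ 2)) := by
    intro l
    rw [norm_mul, norm_mul, norm_star, Complex.norm_real, Real.norm_eq_abs]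
    have f1 : ‖V i l‖ * ‖V j l‖ ≤ (‖V i l‖ ^ 2 + ‖V j l‖ ^ 2) / 2 := by
      linarith [sq_nonneg (‖V i l‖ - ‖V j l‖), sub_sq ‖V i l‖ ‖V j l‖]
    refine (mul_le_mul (hb l) f1 (by positivity) ((abs_nonneg _).trans (hb l))).trans (le_of_eq ?_)
    field_simp
    ring
  rw [h3 (μ r) i j hij]
  refine (norm_sum_le _ _).trans ((Finset.sum_le_sum fun l _ => e1 l).trans ?_)
  simp only [Finset.sum_add_distrib, ← Finset.mul_sum, h1]
  have e2 := mul_le_mul_of_nonneg_left (hρ i hi) (show 0 ≤ 1 / (4 * δ) by positivity)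
  have e3 := mul_le_mul_of_nonneg_left (hρ j hj) (show 0 ≤ 1 / (4 * δ) by positivity)
  have e4 : 1 / (4 * δ) * (2 * Q ^ 2) = Q ^ 2 / δ / 2 := by field_simp; ring
  rw [e4] at e2 e3
  linarith

end Clustered

/-! ### The order of the pairs in a sweep -/

lemma mem_sweepPairs {p : Fin n × Fin n} : p ∈ sweepPairs n ↔ p.1 < p.2 := by
  obtain ⟨l, m⟩ := p
  simp [sweepPairs]

lemma sweepPairs_sorted : (sweepPairs n).Pairwise
    fun p q => p.1 < q.1 ∨ p.1 = q.1 ∧ p.2 < q.2 := by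
  rw [sweepPairs, List.pairwise_flatMap]
  constructor
  · intro l _
    rw [List.pairwise_map]
    refine ((List.pairwise_lt_finRange n).filter _).imp ?_
    intro a b hab
    exact Or.inr ⟨rfl, hab⟩
  · refine (List.pairwise_lt_finRange n).imp ?_
    intro a b hab p hp q hq
    simp only [List.mem_map, List.mem_filter] at hp hq
    obtain ⟨_, _, rfl⟩ := hp
    obtain ⟨_, _, rfl⟩ := hq
    exact Or.inl hab

lemma length_sweepPairs : (sweepPairs n).length = sweepLength n := by
  have h : ∀ l : Fin n, (((List.finRange n).filter fun m => l < m).map fun m => (l, m)).length =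
      n - 1 - l := by
    intro l
    rw [List.length_map, ← Fin.card_Ioi]
    have : Finset.Ioi l = ((List.finRange n).filter fun m => l < m).toFinset := by
      ext m; simp
    rw [this, List.toFinset_card_of_nodup ((List.nodup_finRange n).filter _)]
  rw [sweepPairs, List.length_flatMap, List.map_congr_left fun l _ => h l, sweepLength,
    ← Finset.sum_range_id_mul_two, Nat.mul_div_cancel _ two_pos]
  rw [← Finset.sum_range_reflect, ← Fin.sum_univ_eq_sum_range (fun i => n - 1 - i)]
  rw [List.sum_ofFn.symm.trans (by rw [List.ofFn_eq_map])]

lemma two_mul_sweepLength : 2 * (sweepLength n : ℝ) = (n : ℝ) ^ 2 - n := by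
  have h : sweepLength n * 2 = n * (n - 1) :=
    Nat.div_mul_cancel (Nat.even_mul_pred_self n).two_dvd
  have h2 := congrArg (Nat.cast : ℕ → ℝ) h
  rcases n.eq_zero_or_pos with rfl | hn
  · simp [sweepLength]
  · rw [Nat.cast_mul, Nat.cast_mul, Nat.cast_sub hn] at h2
    push_cast at h2
    linarith

/-- The list is strictly increasing lexicographically, so its prefixes are initial segments of the
order. -/
lemma mem_take_sweepPairs {t : ℕ} (ht : t < (sweepPairs n).length) {p : Fin n × Fin n} :
    p ∈ (sweepPairs n).take t ↔ p.1 < p.2 ∧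
      (p.1 < (sweepPairs n)[t].1 ∨ p.1 = (sweepPairs n)[t].1 ∧ p.2 < (sweepPairs n)[t].2) := by
  have hs := List.pairwise_iff_getElem.1 (sweepPairs_sorted (n := n))
  constructor
  · intro hp
    refine ⟨mem_sweepPairs.1 (List.mem_of_mem_take hp), ?_⟩
    obtain ⟨i, hi, rfl⟩ := List.mem_iff_getElem.1 hp
    rw [List.length_take] at hi
    rw [List.getElem_take]
    exact hs i t _ ht (by omega)
  · rintro ⟨h1, h2⟩
    obtain ⟨i, hi, rfl⟩ := List.mem_iff_getElem.1 (mem_sweepPairs.2 h1)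
    rcases lt_or_ge i t with hit | hit
    · exact List.mem_take_iff_getElem.2 ⟨i, by omega, rfl⟩
    · exfalso
      rcases hit.eq_or_lt with rfl | hit
      · rcases h2 with h2 | h2
        · exact lt_irrefl _ h2
        · exact lt_irrefl _ h2.2
      · have := hs t i ht hi hit
        rcases h2 with h2 | ⟨h2, h3⟩ <;> rcases this with h4 | ⟨h4, h5⟩
        · exact lt_asymm h2 h4
        · exact h2.ne h4.symm
        · exact h4.ne h2.symm
        · exact lt_asymm h3 h5

lemma mem_take_succ {t : ℕ} (ht : t < (sweepPairs n).length) {p : Fin n × Fin n} :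
    p ∈ (sweepPairs n).take (t + 1) ↔ p ∈ (sweepPairs n).take t ∨ p = (sweepPairs n)[t] := by
  rw [List.take_add_one, List.mem_append, List.getElem?_eq_getElem ht]
  simp

/-- Comparing and exchanging along a sweep sorts. -/
lemma antitone_of_exchange {v : ℕ → Fin n → ℝ}
    (hv : ∀ t (ht : t < (sweepPairs n).length),
      (v t (sweepPairs n)[t].1 < v t (sweepPairs n)[t].2 →
        v (t + 1) = v t ∘ Equiv.swap (sweepPairs n)[t].1 (sweepPairs n)[t].2) ∧
      (v t (sweepPairs n)[t].2 ≤ v t (sweepPairs n)[t].1 → v (t + 1) = v t)) :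
    Antitone (v (sweepPairs n).length) := by
  -- Invariant of the exchange sort: all pairs already compared are in order.
  have key : ∀ t ≤ (sweepPairs n).length, ∀ p ∈ (sweepPairs n).take t, v t p.2 ≤ v t p.1 := by
    intro t
    induction t with
    | zero => simp
    | succ t ih =>
      intro ht p hp
      have ih := ih (by omega)
      obtain ⟨h1, h2⟩ := hv t ht
      have hmem := @mem_take_sweepPairs n t ht
      have hlm : (sweepPairs n)[t].1 < (sweepPairs n)[t].2 := mem_sweepPairs.1 (List.getElem_mem ht)
      rw [mem_take_succ ht] at hp
      generalize (sweepPairs n)[t] = q at *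
      obtain ⟨l, m⟩ := q
      obtain ⟨i, j⟩ := p
      simp only at h1 h2 hlm hmem hp ⊢
      rcases lt_or_ge (v t l) (v t m) with hlt | hge
      · rw [h1 hlt]
        simp only [Function.comp]
        rcases hp with hp | hp
        · obtain ⟨hij, hil | ⟨rfl, hjm⟩⟩ := hmem.1 hp
          · rw [Equiv.swap_apply_of_ne_of_ne hil.ne (hil.trans hlm).ne]
            rw [Equiv.swap_apply_def]
            split_ifs with hj hj'
            · exact ih (i, m) (hmem.2 ⟨hil.trans hlm, Or.inl hil⟩)
            · exact ih (i, l) (hmem.2 ⟨hil, Or.inl hil⟩)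
            · exact ih (i, j) hp
          -- Position `l` holds the maximum of its row so far, and the exchange only raises it. For
          -- rows above `l` everything to the right has already been compared.
          · rw [Equiv.swap_apply_left, Equiv.swap_apply_of_ne_of_ne hij.ne' hjm.ne]
            exact (ih (i, j) hp).trans hlt.le
        · obtain ⟨rfl, rfl⟩ := Prod.mk.inj hp
          rw [Equiv.swap_apply_left, Equiv.swap_apply_right]
          exact hlt.le
      · rw [h2 hge]
        rcases hp with hp | hp
        · exact ih (i, j) hp
        · obtain ⟨rfl, rfl⟩ := Prod.mk.inj hp
          exact hge
  intro i j hij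
  rcases hij.eq_or_lt with rfl | hij
  · exact le_rfl
  · refine key _ le_rfl (i, j) ?_
    rw [List.take_length]
    exact mem_sweepPairs.2 hij

/-! ### Sweeps of rotations -/

/-- `A 0, A 1, …` are the matrices of a sweep without the final permutation. -/
def IsSweep (η : ℝ) (A : ℕ → Matrix (Fin n) (Fin n) ℂ) : Prop :=
  ∀ t (ht : t < (sweepPairs n).length), ∃ θ φ : ℝ,
    LineSearchOutcome η (A t) (sweepPairs n)[t].1 (sweepPairs n)[t].2 θ φ ∧
      A (t + 1) = rotate (sweepPairs n)[t].1 (sweepPairs n)[t].2 θ φ (A t)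

lemma getElem_sweepPairs_ne {t : ℕ} (ht : t < (sweepPairs n).length) :
    (sweepPairs n)[t].1 ≠ (sweepPairs n)[t].2 :=
  (mem_sweepPairs.1 (List.getElem_mem ht)).ne

/-- The full off-diagonal set does not separate `l` from `m`, so only the pivot changes the sum. -/
lemma offNorm_rotate_sq_le {η : ℝ} {A : Matrix (Fin n) (Fin n) ℂ}
    (hA : A.IsHermitian) {l m : Fin n} (hlm : l ≠ m) {θ φ : ℝ}
    (h : LineSearchOutcome η A l m θ φ) :
    offNorm (rotate l m θ φ A) ^ 2 ≤ offNorm A ^ 2 + 5 / 2 * η ^ 2 * frobNorm A ^ 2 := by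
  have h1 := frobNorm_mask_rotate_sq (T := (· ≠ ·)) hlm (fun x y => ne_comm) (fun x => by simp)
    (fun x hl hm => by simp [hl.symm, hm.symm]) θ φ hA
  rw [if_pos hlm, ← offNorm_sq hA, ← offNorm_sq (isHermitian_rotate l m θ φ hA)] at h1
  have h2 := norm_rotate_pivot_sq_le hA hlm h
  linarith [sq_nonneg ‖A l m‖]

namespace IsSweep

variable {A : ℕ → Matrix (Fin n) (Fin n) ℂ} {ev μ κ : Fin n → ℝ} {η s δ : ℝ}

lemma spectralForm (h : IsSweep η A) (h0 : SpectralForm (A 0) ev) :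
    ∀ t ≤ (sweepPairs n).length, SpectralForm (A t) ev := by
  intro t
  induction t with
  | zero => exact fun _ => h0
  | succ t ih =>
    intro ht
    obtain ⟨θ, φ, -, he⟩ := h t ht
    rw [he]
    exact (ih (by omega)).rotate (getElem_sweepPairs_ne ht) θ φ

lemma frobNorm_eq (h : IsSweep η A) (h0 : SpectralForm (A 0) ev) {t : ℕ}
    (ht : t ≤ (sweepPairs n).length) : frobNorm (A t) = frobNorm (A 0) := by
  rw [(h.spectralForm h0 t ht).frobNorm_eq, h0.frobNorm_eq]

lemma offNorm_sq_le (h : IsSweep η A) (h0 : SpectralForm (A 0) ev) : ∀ t ≤ (sweepPairs n).length,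
    offNorm (A t) ^ 2 ≤ offNorm (A 0) ^ 2 + 5 / 4 * ((n : ℝ) ^ 2 - n) * η ^ 2 * frobNorm (A 0) ^ 2 := by
  have key : ∀ t ≤ (sweepPairs n).length,
      offNorm (A t) ^ 2 ≤ offNorm (A 0) ^ 2 + t * (5 / 2 * η ^ 2 * frobNorm (A 0) ^ 2) := by
    intro t
    induction t with
    | zero => simp
    | succ t ih =>
      intro ht
      obtain ⟨θ, φ, ho, he⟩ := h t ht
      have h1 := offNorm_rotate_sq_le (h.spectralForm h0 t (by omega)).isHermitian
        (getElem_sweepPairs_ne ht) ho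
      rw [h.frobNorm_eq h0 (by omega)] at h1
      rw [he]
      have h2 := ih (by omega)
      push_cast
      linarith
  intro t ht
  refine (key t ht).trans ?_
  have h1 : (t : ℝ) ≤ sweepLength n := by
    rw [length_sweepPairs] at ht
    exact_mod_cast ht
  have h2 := mul_le_mul_of_nonneg_right h1
    (show 0 ≤ 5 / 2 * η ^ 2 * frobNorm (A 0) ^ 2 by positivity)
  rw [← two_mul_sweepLength]
  linarith

/-- The diagonal entries stay in their clusters during a sweep. -/
lemma diag_near (h : IsSweep η A) (h0 : SpectralForm (A 0) ev) (hc : Clustered ev μ s δ)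
    (hP : ∀ t ≤ (sweepPairs n).length, offNorm (A t) ≤ 2 / 5 * δ)
    (hη : η * frobNorm (A 0) ≤ δ / 16) (hκ : ∀ i, κ i ∈ Set.range μ)
    (hκ0 : ∀ i, |(A 0 i i).re - κ i| ≤ δ / 2) :
    ∀ t ≤ (sweepPairs n).length, ∀ i, |(A t i i).re - κ i| ≤ offNorm (A t) + s := by
  have hs := hc.small
  have hδ := hc.pos
  have key : ∀ t ≤ (sweepPairs n).length, ∀ i, |(A t i i).re - κ i| ≤ δ / 2 →
      |(A t i i).re - κ i| ≤ offNorm (A t) + s := by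
    intro t ht i hi
    obtain ⟨x, hx, hx'⟩ := hc.exists_center_near (h.spectralForm h0 t ht) i
    -- Some centre is this close by spectral localization; separation identifies it with `κ i`.
    rwa [hc.eq_of_near (hκ i) hx (u := (A t i i).re) (v := (A t i i).re)]
    rw [sub_self, abs_zero]
    linarith [hP t ht]
  intro t
  induction t with
  | zero => exact fun ht i => key 0 ht i (hκ0 i)
  | succ t ih =>
    intro ht i
    have ht' : t ≤ (sweepPairs n).length := by omega
    obtain ⟨θ, φ, ho, he⟩ := h t ht
    have h1 := abs_rotate_diag_sub_le (h.spectralForm h0 t ht').isHermitian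
      (getElem_sweepPairs_ne ht) ho i
    rw [h.frobNorm_eq h0 ht', ← he] at h1
    have h2 := ih ht' i
    obtain ⟨x, hx, hx'⟩ := hc.exists_center_near (h.spectralForm h0 (t + 1) ht) i
    -- Both distances to centres and the move of one rotation add up to less than `3 * δ`, so the
    -- centre cannot change.
    rwa [hc.eq_of_near (hκ i) hx (u := (A t i i).re) (v := (A (t + 1) i i).re)]
    rw [abs_sub_comm] at h1
    linarith [hP t ht', hP (t + 1) ht]

end IsSweep

lemma mask_add (T : Fin n → Fin n → Prop) (A B : Matrix (Fin n) (Fin n) ℂ) :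
    mask T (A + B) = mask T A + mask T B := by
  ext i j
  simp only [mask_apply, Matrix.add_apply]
  split_ifs <;> simp

lemma frobNorm_mask_le {T : Fin n → Fin n → Prop} {B : Matrix (Fin n) (Fin n) ℂ} {r : ℝ}
    (hr : 0 ≤ r) (h : ∀ x y, T x y → ‖B x y‖ ≤ r) : frobNorm (mask T B) ≤ n * r := by
  refine (sq_le_sq₀ (frobNorm_nonneg _) (by positivity)).1 ?_
  rw [frobNorm_sq]
  have : ∀ x y, ‖mask T B x y‖ ^ 2 ≤ r ^ 2 := by
    intro x y
    refine pow_le_pow_left₀ (norm_nonneg _) ?_ 2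
    rw [mask_apply]
    split_ifs with hT
    · exact h x y hT
    · rwa [norm_zero]
  refine (Finset.sum_le_sum fun x _ => Finset.sum_le_sum fun y _ => this x y).trans (le_of_eq ?_)
  simp
  ring

lemma frobNorm_mask_insert_sq {T T' : Fin n → Fin n → Prop} {l m : Fin n}
    (hT : ∀ x y, T' x y → T x y ∨ (x = l ∧ y = m) ∨ (x = m ∧ y = l))
    {B : Matrix (Fin n) (Fin n) ℂ} (hB : B.IsHermitian) :
    frobNorm (mask T' B) ^ 2 ≤ frobNorm (mask T B) ^ 2 + 2 * ‖B l m‖ ^ 2 := by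
  classical
  have h : ∀ x y, (if T' x y then ‖B x y‖ ^ 2 else 0) ≤ (if T x y then ‖B x y‖ ^ 2 else 0) +
      ((if y = m then if x = l then ‖B l m‖ ^ 2 else 0 else 0) +
      (if y = l then if x = m then ‖B l m‖ ^ 2 else 0 else 0)) := by
    intro x y
    have h0 : 0 ≤ ‖B x y‖ ^ 2 := by positivity
    have h1 : 0 ≤ (if T x y then ‖B x y‖ ^ 2 else 0) := by split_ifs <;> positivity
    have h2 : 0 ≤ (if y = m then if x = l then ‖B l m‖ ^ 2 else 0 else 0) := by
      split_ifs <;> positivity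
    have h3 : 0 ≤ (if y = l then if x = m then ‖B l m‖ ^ 2 else 0 else 0) := by
      split_ifs <;> positivity
    by_cases hxy : T' x y
    · rw [if_pos hxy]
      rcases hT x y hxy with hT | ⟨rfl, rfl⟩ | ⟨rfl, rfl⟩
      · rw [if_pos hT] at h1 ⊢
        linarith
      · rw [if_pos rfl, if_pos rfl] at h2 ⊢
        linarith
      · rw [if_pos rfl, if_pos rfl, norm_apply_comm hB x y] at *
        linarith
    · rw [if_neg hxy]
      linarith
  rw [frobNorm_mask_sq, frobNorm_mask_sq]
  refine (Finset.sum_le_sum fun x _ => Finset.sum_le_sum fun y _ => h x y).trans (le_of_eq ?_)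
  simp only [Finset.sum_add_distrib, Finset.sum_ite_eq', Finset.mem_univ, if_true]
  ring

/-- A rotation by a small angle changes the entries off the pivot block little. -/
lemma norm_rotate_sub_le {l m : Fin n} (hlm : l ≠ m) {θ φ σ Q : ℝ}
    {A : Matrix (Fin n) (Fin n) ℂ} (hA : A.IsHermitian) (hs : |Real.sin θ| ≤ σ)
    (hc : |Real.cos θ - 1| ≤ σ) (hQ : offNorm A ≤ Q) {x y : Fin n} (hxy : x ≠ y)
    (h : ¬ ((x = l ∨ x = m) ∧ (y = l ∨ y = m))) :
    ‖rotate l m θ φ A x y - A x y‖ ≤ 2 * σ * Q := by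
  have hσ : 0 ≤ σ := (abs_nonneg _).trans hs
  have hQ0 : 0 ≤ Q := (offNorm_nonneg A).trans hQ
  have hent : ∀ x y, x ≠ y → ‖A x y‖ ≤ Q := fun x y h => (norm_apply_le_offNorm hA h).trans hQ
  have hc' : ‖(Real.cos θ : ℂ) - 1‖ ≤ σ := by
    rw [← Complex.ofReal_one, ← Complex.ofReal_sub, Complex.norm_real]
    exact hc
  have hs' : ‖rotSin θ φ‖ ≤ σ := by rwa [norm_rotSin]
  have key : ∀ x y, x ≠ l → x ≠ m → x ≠ y → ‖rotate l m θ φ A x y - A x y‖ ≤ 2 * σ * Q := by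
    intro x y hl hm hxy
    by_cases hyl : y = l
    · rw [hyl, rotate, mul_planeRotation_left hlm, planeRotation_mul_other _ _ _ _ hl hm,
        planeRotation_mul_other _ _ _ _ hl hm]
      have e : A x l * (Real.cos θ : ℂ) + A x m * rotSin θ φ - A x l =
          A x l * ((Real.cos θ : ℂ) - 1) + A x m * rotSin θ φ := by ring
      rw [e]
      refine (norm_add_le _ _).trans ?_
      rw [norm_mul, norm_mul]
      have := mul_le_mul (hent x l hl) hc' (norm_nonneg _) hQ0
      have := mul_le_mul (hent x m hm) hs' (norm_nonneg _) hQ0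
      linarith
    by_cases hym : y = m
    · rw [hym, rotate, mul_planeRotation_right hlm, planeRotation_mul_other _ _ _ _ hl hm,
        planeRotation_mul_other _ _ _ _ hl hm]
      have e : A x m * (Real.cos θ : ℂ) - A x l * star (rotSin θ φ) - A x m =
          A x m * ((Real.cos θ : ℂ) - 1) - A x l * star (rotSin θ φ) := by ring
      rw [e]
      refine (norm_sub_le _ _).trans ?_
      rw [norm_mul, norm_mul, norm_star]
      have := mul_le_mul (hent x m hm) hc' (norm_nonneg _) hQ0
      have := mul_le_mul (hent x l hl) hs' (norm_nonneg _) hQ0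
      linarith
    · rw [rotate, mul_planeRotation_other _ _ _ _ hyl hym, planeRotation_mul_other _ _ _ _ hl hm,
        sub_self, norm_zero]
      positivity
  by_cases hx : x = l ∨ x = m
  · have hy : ¬ (y = l ∨ y = m) := fun hy => h ⟨hx, hy⟩
    have hH : (rotate l m θ φ A - A).IsHermitian := (isHermitian_rotate l m θ φ hA).sub hA
    have := norm_apply_comm hH x y
    rw [Matrix.sub_apply, Matrix.sub_apply] at this
    rw [this]
    exact key y x (fun h => hy (Or.inl h)) (fun h => hy (Or.inr h)) hxy.symm
  · exact key x y (fun h => hx (Or.inl h)) (fun h => hx (Or.inr h)) hxy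

/-! ### Quadratic reduction over contiguous clusters. -/

/-- The positions between different clusters that the first `t` rotations of a sweep have treated. -/
def Treated (κ : Fin n → ℝ) (t : ℕ) (x y : Fin n) : Prop :=
  κ x ≠ κ y ∧ ((x, y) ∈ (sweepPairs n).take t ∨ (y, x) ∈ (sweepPairs n).take t)

lemma treated_comm {κ : Fin n → ℝ} {t : ℕ} (x y : Fin n) : Treated κ t x y ↔ Treated κ t y x := by
  rw [Treated, Treated, ne_comm, or_comm]

lemma treated_succ {κ : Fin n → ℝ} {t : ℕ} (ht : t < (sweepPairs n).length) {x y : Fin n}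
    (h : Treated κ (t + 1) x y) : Treated κ t x y ∨
      (x = (sweepPairs n)[t].1 ∧ y = (sweepPairs n)[t].2) ∨
      (x = (sweepPairs n)[t].2 ∧ y = (sweepPairs n)[t].1) := by
  obtain ⟨h1, h2⟩ := h
  rw [mem_take_succ ht, mem_take_succ ht] at h2
  rcases h2 with (h2 | h2) | h2 | h2
  · exact Or.inl ⟨h1, Or.inl h2⟩
  · rw [← h2]
    exact Or.inr (Or.inl ⟨rfl, rfl⟩)
  · exact Or.inl ⟨h1, Or.inr h2⟩
  · rw [← h2]
    exact Or.inr (Or.inr ⟨rfl, rfl⟩)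

lemma not_treated_pivot {κ : Fin n → ℝ} {t : ℕ} (ht : t < (sweepPairs n).length) :
    ¬ Treated κ t (sweepPairs n)[t].1 (sweepPairs n)[t].2 := by
  rintro ⟨-, h | h⟩
  · rw [mem_take_sweepPairs ht] at h
    simp at h
  · have h1 := mem_sweepPairs.1 (List.mem_of_mem_take h)
    exact lt_asymm h1 (mem_sweepPairs.1 (List.getElem_mem ht))

/-- When the clusters are contiguous, the treated positions do not separate the two indices of a
rotation within a cluster. -/
lemma treated_iff_of_eq {κ : Fin n → ℝ} (hκ : Antitone κ) {t : ℕ}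
    (ht : t < (sweepPairs n).length)
    (he : κ (sweepPairs n)[t].1 = κ (sweepPairs n)[t].2) {x : Fin n} (hx : x ≠ (sweepPairs n)[t].1)
    (hx' : x ≠ (sweepPairs n)[t].2) :
    Treated κ t (sweepPairs n)[t].1 x ↔ Treated κ t (sweepPairs n)[t].2 x := by
  have hlm : (sweepPairs n)[t].1 < (sweepPairs n)[t].2 := mem_sweepPairs.1 (List.getElem_mem ht)
  simp only [Treated, mem_take_sweepPairs ht, he]
  refine and_congr_right fun hne => ?_
  generalize (sweepPairs n)[t] = q at *
  obtain ⟨l, m⟩ := q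
  simp only at *
  rcases lt_trichotomy x l with h | h | h
  · simp [h, h.trans hlm]
  · exact absurd h hx
  -- An index strictly between `l` and `m` would share their centre by monotonicity.
  · have h2 : m < x := by
      rcases lt_trichotomy x m with h2 | h2 | h2
      · exact absurd (le_antisymm (he ▸ hκ h.le) (hκ h2.le)) hne.symm
      · exact absurd h2 hx'
      · exact h2
    simp [h, h2, h.not_gt, h2.not_gt, hlm.not_gt, hlm.ne', hx]

namespace IsSweep

variable {A : ℕ → Matrix (Fin n) (Fin n) ℂ} {ev μ κ : Fin n → ℝ} {η s δ P : ℝ}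

lemma frobNorm_treated_step (h : IsSweep η A) (h0 : SpectralForm (A 0) ev)
    (hc : Clustered ev μ s δ) (hanti : Antitone κ) (hκ : ∀ i, κ i ∈ Set.range μ)
    (hnear : ∀ t ≤ (sweepPairs n).length, ∀ i, |(A t i i).re - κ i| ≤ 3 * P)
    (hP : ∀ t ≤ (sweepPairs n).length, offNorm (A t) ≤ 2 * P) (hPδ : P ≤ δ / 16)
    (hη : 0 ≤ η) (hηP : η * frobNorm (A 0) ≤ P) {t : ℕ} (ht : t < (sweepPairs n).length) :
    frobNorm (mask (Treated κ (t + 1)) (A (t + 1))) ^ 2 ≤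
      (frobNorm (mask (Treated κ t) (A t)) + n * (12 * (P ^ 2 / δ))) ^ 2 +
        5 * η ^ 2 * frobNorm (A 0) ^ 2 := by
  have hδ := hc.pos
  have hA := (h.spectralForm h0 t ht.le).isHermitian
  have hA' := (h.spectralForm h0 (t + 1) ht).isHermitian
  have hlm := getElem_sweepPairs_ne ht
  have hT0 := not_treated_pivot (κ := κ) ht
  have hTs := fun x y => treated_succ (κ := κ) (x := x) (y := y) ht
  have hTe := fun (he : κ (sweepPairs n)[t].1 = κ (sweepPairs n)[t].2) x hx hx' =>
    treated_iff_of_eq hanti ht he (x := x) hx hx'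
  have hN := h.frobNorm_eq h0 ht.le
  obtain ⟨θ, φ, ho, he⟩ := h t ht
  generalize (sweepPairs n)[t] = q at *
  obtain ⟨l, m⟩ := q
  simp only at *
  have hP0 : 0 ≤ P := by linarith [hP t ht.le, offNorm_nonneg (A t)]
  have hD0 := frobNorm_nonneg (mask (Treated κ t) (A t))
  by_cases hlmκ : κ l = κ m
  -- Inside a cluster the angle is uncontrolled, but no treated position is added and the treated
  -- sum is invariant.
  · have hTT : Treated κ (t + 1) = Treated κ t := by
      ext x y
      constructor
      · intro hxy
        rcases hTs x y hxy with h1 | ⟨rfl, rfl⟩ | ⟨rfl, rfl⟩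
        · exact h1
        · exact absurd hlmκ hxy.1
        · exact absurd hlmκ.symm hxy.1
      · rintro ⟨h1, h2⟩
        refine ⟨h1, h2.imp ?_ ?_⟩ <;>
          exact fun hm => (List.take_subset_take_left _ (Nat.le_succ t)) hm
    have h1 := frobNorm_mask_rotate_sq hlm (T := Treated κ t) treated_comm (fun x hx => hx.1 rfl)
      (hTe hlmκ) θ φ hA
    rw [if_neg hT0, add_zero, ← he] at h1
    rw [hTT, h1]
    have h2 : 0 ≤ 5 * η ^ 2 * frobNorm (A 0) ^ 2 := by positivity
    have h3 : 0 ≤ n * (12 * (P ^ 2 / δ)) := by positivity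
    have h4 := pow_le_pow_left₀ hD0 (le_add_of_nonneg_right h3) 2
    linarith
  · have h1 := frobNorm_mask_insert_sq hTs hA'
    have h2 := norm_rotate_pivot_sq_le hA hlm ho
    rw [← he, hN] at h2
    have hgap : 2 * δ ≤ |(A t l l).re - (A t m m).re| := by
      by_contra hcon
      push Not at hcon
      refine hlmκ (hc.eq_of_near (hκ l) (hκ m) (u := (A t l l).re) (v := (A t m m).re) ?_)
      linarith [hnear t ht.le l, hnear t ht.le m]
    -- Two diagonal entries `2 * δ` apart force a large norm; this turns the bound on `η * frobNorm
    -- (A 0)` into one on `η` itself.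
    have hδN : δ ≤ frobNorm (A 0) := by
      rw [← hN]
      refine (sq_le_sq₀ hδ.le (frobNorm_nonneg _)).1 ?_
      have e1 := block_le_frobNorm_sq hA hlm
      have e2 := pow_le_pow_left₀ (abs_nonneg _) (Complex.abs_re_le_norm (A t l l)) 2
      have e3 := pow_le_pow_left₀ (abs_nonneg _) (Complex.abs_re_le_norm (A t m m)) 2
      have e4 := pow_le_pow_left₀ (by positivity) hgap 2
      rw [sq_abs] at e2 e3 e4
      linarith [sq_nonneg ((A t l l).re + (A t m m).re), sq_nonneg ‖A t l m‖,
        add_sq (A t l l).re (A t m m).re, sub_sq (A t l l).re (A t m m).re, mul_pow 2 δ 2,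
        sq_nonneg δ]
    have hηδ : η ≤ P / δ := by
      rw [le_div_iff₀ hδ]
      exact (mul_le_mul_of_nonneg_left hδN hη).trans hηP
    have hPδ' : offNorm (A t) / δ ≤ 2 * P / δ := div_le_div_of_nonneg_right (hP t ht.le) hδ.le
    obtain ⟨hs1, hs2⟩ := angle_small hA hlm ho hδ hgap
    have hσ : offNorm (A t) / δ + η ≤ 3 * (P / δ) := by
      rw [mul_div_assoc] at hPδ'
      linarith
    -- The constant is `12 = 2 * 3 * 2`, from `norm_rotate_sub_le` with sine bound `3 * (P / δ)` and
    -- off-diagonal bound `2 * P`.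
    have h3 : frobNorm (mask (Treated κ t) (A (t + 1) - A t)) ≤ n * (12 * (P ^ 2 / δ)) := by
      refine frobNorm_mask_le (by positivity) fun x y hxy => ?_
      rw [Matrix.sub_apply, he]
      have hxy' : x ≠ y := fun hh => hxy.1 (by rw [hh])
      refine (norm_rotate_sub_le hlm hA (hs1.trans hσ) (hs2.trans hσ) (hP t ht.le) hxy'
        ?_).trans (le_of_eq ?_)
      · rintro ⟨rfl | rfl, rfl | rfl⟩
        · exact hxy' rfl
        · exact hT0 hxy
        · exact hT0 ((treated_comm _ _).1 hxy)
        · exact hxy' rfl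
      · field_simp
        ring
    have h4 : frobNorm (mask (Treated κ t) (A (t + 1))) ≤
        frobNorm (mask (Treated κ t) (A t)) + n * (12 * (P ^ 2 / δ)) := by
      have := frobNorm_add_le (mask (Treated κ t) (A t)) (mask (Treated κ t) (A (t + 1) - A t))
      rw [← mask_add, add_sub_cancel] at this
      linarith
    have h5 := pow_le_pow_left₀ (frobNorm_nonneg _) h4 2
    linarith

/-- A sweep over contiguous clusters reduces the off-diagonal norm quadratically, up to the errors
of the line searches. -/
lemma offNorm_sq_le_quadratic (h : IsSweep η A) (h0 : SpectralForm (A 0) ev)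
    (hc : Clustered ev μ s δ) (hanti : Antitone κ) (hκ : ∀ i, κ i ∈ Set.range μ)
    (hnear : ∀ t ≤ (sweepPairs n).length, ∀ i, |(A t i i).re - κ i| ≤ 3 * P)
    (hP : ∀ t ≤ (sweepPairs n).length, offNorm (A t) ≤ 2 * P) (hPδ : P ≤ δ / 16)
    (hη : 0 ≤ η) (hηP : η * frobNorm (A 0) ≤ P) (hs : s ≤ P ^ 2 / δ) :
    offNorm (A (sweepPairs n).length) ^ 2 ≤
      (432 * (sweepLength n : ℝ) ^ 2 * n ^ 2 + 50 * n ^ 2) * (P ^ 2 / δ) ^ 2 +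
        3 / 2 * ((n : ℝ) ^ 2 - n) * η ^ 2 * frobNorm (A 0) ^ 2 := by
  classical
  have hδ := hc.pos
  set E := P ^ 2 / δ with hE
  have hE0 : 0 ≤ E := by positivity
  -- The drifts of order `E` add linearly, while the pivot errors, collected in `q`, add in squares;
  -- keeping them apart preserves the constant in front of `η ^ 2`.
  have key : ∀ t ≤ (sweepPairs n).length, ∃ q : ℝ, 0 ≤ q ∧
      q ^ 2 ≤ t * (5 * η ^ 2 * frobNorm (A 0) ^ 2) ∧
      frobNorm (mask (Treated κ t) (A t)) ≤ t * (n * (12 * E)) + q := by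
    intro t
    induction t with
    | zero =>
      refine fun _ => ⟨0, le_rfl, by simp, ?_⟩
      have := frobNorm_mask_le (T := Treated κ 0) (B := A 0) le_rfl
        (fun x y hxy => by simp [Treated] at hxy)
      simpa using this
    | succ t ih =>
      intro ht
      obtain ⟨q, hq0, hq, hD⟩ := ih (by omega)
      have hstep := h.frobNorm_treated_step h0 hc hanti hκ hnear hP hPδ hη hηP ht
      have hR : 0 ≤ 5 * η ^ 2 * frobNorm (A 0) ^ 2 := by positivity
      set R := 5 * η ^ 2 * frobNorm (A 0) ^ 2
      have hq2 : Real.sqrt (q ^ 2 + R) ^ 2 = q ^ 2 + R := Real.sq_sqrt (by positivity)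
      have hqq : q ≤ Real.sqrt (q ^ 2 + R) := Real.le_sqrt_of_sq_le (by linarith)
      refine ⟨Real.sqrt (q ^ 2 + R), Real.sqrt_nonneg _, ?_, ?_⟩
      · rw [hq2]
        push_cast
        linarith
      · have ha : 0 ≤ n * (12 * E) := by positivity
        refine (sq_le_sq₀ (frobNorm_nonneg _) (by positivity)).1 (hstep.trans ?_)
        push_cast
        rw [← hE]
        set a := n * (12 * E)
        have e1 := pow_le_pow_left₀ (add_nonneg (frobNorm_nonneg _) ha)
          (add_le_add_left hD a) 2
        have e2 : 0 ≤ (t + 1) * a := by positivity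
        have e3 := mul_le_mul_of_nonneg_left hqq e2
        nlinarith
  obtain ⟨q, hq0, hq, hD⟩ := key _ le_rfl
  have hA := (h.spectralForm h0 _ le_rfl)
  have hP0 : 0 ≤ P := by linarith [hP 0 (Nat.zero_le _), offNorm_nonneg (A 0)]
  -- At the end every position between clusters is treated. The others obey the spectral bound with
  -- `Q = 3 * P`, hence `s + 9 * E ≤ 10 * E`.
  have hlast : frobNorm (mask (· ≠ ·) (A (sweepPairs n).length)) ^ 2 ≤
      frobNorm (mask (Treated κ (sweepPairs n).length) (A (sweepPairs n).length)) ^ 2 +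
        n ^ 2 * (10 * E) ^ 2 := by
    have hent : ∀ x y, (if x ≠ y then ‖A (sweepPairs n).length x y‖ ^ 2 else 0) ≤
        (if Treated κ (sweepPairs n).length x y then ‖A (sweepPairs n).length x y‖ ^ 2 else 0) +
          (10 * E) ^ 2 := by
      intro x y
      have hE2 : 0 ≤ (10 * E) ^ 2 := by positivity
      by_cases hxy : x = y
      · rw [if_neg (not_not.2 hxy)]
        split_ifs <;> positivity
      rw [if_pos hxy]
      by_cases hk : κ x = κ y
      · have h1 : offNorm (A (sweepPairs n).length) ≤ 3 * P := by linarith [hP _ le_rfl]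
        have h2 := hc.norm_apply_le hA hxy (hκ x) h1 (hnear _ le_rfl x)
          (by rw [hk]; exact hnear _ le_rfl y)
        have h3 : (3 * P) ^ 2 / δ = 9 * E := by rw [hE]; ring
        have h4 := pow_le_pow_left₀ (norm_nonneg _) (h2.trans (b := s + (3 * P) ^ 2 / δ)
          (show _ ≤ 10 * E by rw [h3]; linarith)) 2
        have h5 : 0 ≤ (if Treated κ (sweepPairs n).length x y then
            ‖A (sweepPairs n).length x y‖ ^ 2 else 0) := by split_ifs <;> positivity
        linarith
      · have hT : Treated κ (sweepPairs n).length x y := by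
          refine ⟨hk, ?_⟩
          rw [List.take_length, mem_sweepPairs, mem_sweepPairs]
          exact lt_or_gt_of_ne hxy
        rw [if_pos hT]
        linarith
    rw [frobNorm_mask_sq, frobNorm_mask_sq]
    refine (Finset.sum_le_sum fun x _ => Finset.sum_le_sum fun y _ => hent x y).trans
      (le_of_eq ?_)
    simp only [Finset.sum_add_distrib, Finset.sum_const, Finset.card_univ, Fintype.card_fin,
      nsmul_eq_mul]
    rw [sq (n : ℝ), mul_assoc]
  rw [← offNorm_sq hA.isHermitian] at hlast
  rw [length_sweepPairs] at *
  have h1 := pow_le_pow_left₀ (frobNorm_nonneg _) hD 2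
  set a := (sweepLength n : ℝ) * (n * (12 * E)) with ha
  -- The weights put most of the loss on `a`; the factor `6 / 5` on `q ^ 2` yields the coefficient
  -- `3 / 2`, below the permitted 2.
  have h2 : (a + q) ^ 2 ≤ 6 * a ^ 2 + 6 / 5 * q ^ 2 := by linarith [sq_nonneg (5 * a - q), sub_sq (5 * a) q, add_sq a q]
  have h3 : a ^ 2 = 144 * (sweepLength n : ℝ) ^ 2 * n ^ 2 * E ^ 2 := by rw [ha]; ring
  rw [← two_mul_sweepLength]
  linarith

end IsSweep

lemma frobNorm_mask_submatrix (A : Matrix (Fin n) (Fin n) ℂ) (σ : Equiv.Perm (Fin n)) :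
    frobNorm (mask (· ≠ ·) (A.submatrix σ σ)) = frobNorm (mask (· ≠ ·) A) := by
  refine (sq_eq_sq₀ (frobNorm_nonneg _) (frobNorm_nonneg _)).1 ?_
  rw [frobNorm_mask_sq, frobNorm_mask_sq,
    ← Equiv.sum_comp σ fun i => ∑ j, if i ≠ j then ‖A i j‖ ^ 2 else 0]
  refine Finset.sum_congr rfl fun i _ => ?_
  rw [← Equiv.sum_comp σ fun j => if σ i ≠ j then ‖A (σ i) j‖ ^ 2 else 0]
  simp

lemma offNorm_submatrix {A : Matrix (Fin n) (Fin n) ℂ} (hA : A.IsHermitian)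
    (σ : Equiv.Perm (Fin n)) : offNorm (A.submatrix σ σ) = offNorm A := by
  refine (sq_eq_sq₀ (offNorm_nonneg _) (offNorm_nonneg _)).1 ?_
  have h1 := offNorm_sq (hA.submatrix σ)
  rw [frobNorm_mask_submatrix, ← offNorm_sq hA] at h1
  linarith

/-! ### The runs of the algorithm -/

variable (G : Matrix (Fin n) (Fin n) ℂ) (θ φ : ℕ → ℝ)

lemma state_succ {k : ℕ} {l m : Fin n} (h : pairAt n k = some (l, m)) :
    state G θ φ (k + 1) =
      let W := (state G θ φ k).1 * planeRotation l m (θ k) (φ k)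
      let I := updateTable (Wᴴ * G * W) (state G θ φ k).2 l m
      if (k + 1) % sweepLength n = 0 then (W.submatrix id I, 1) else (W, I) := by
  rw [state, h]

lemma state_succ_of_none {k : ℕ} (h : pairAt n k = none) :
    state G θ φ (k + 1) = state G θ φ k := by
  rw [state, h]

lemma pairAt_add {k t : ℕ} (hk : sweepLength n ∣ k) (ht : t < (sweepPairs n).length) :
    pairAt n (k + t) = some (sweepPairs n)[t] := by
  have ht' := ht
  rw [length_sweepPairs] at ht'
  obtain ⟨q, rfl⟩ := hk
  rw [pairAt, Nat.mul_add_mod, Nat.mod_eq_of_lt ht', List.getElem?_eq_getElem ht]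

lemma lt_of_pairAt {k : ℕ} {l m : Fin n} (h : pairAt n k = some (l, m)) : l < m :=
  mem_sweepPairs.1 (List.mem_of_getElem? h)

lemma state_unitary (k : ℕ) : (state G θ φ k).1 * ((state G θ φ k).1)ᴴ = 1 := by
  induction k with
  | zero => simp [state]
  | succ k ih =>
    rcases hp : pairAt n k with _ | ⟨l, m⟩
    · rw [state_succ_of_none G θ φ hp, ih]
    · rw [state_succ G θ φ hp]
      have hW : (state G θ φ k).1 * planeRotation l m (θ k) (φ k) *
          ((state G θ φ k).1 * planeRotation l m (θ k) (φ k))ᴴ = 1 := by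
        rw [Matrix.conjTranspose_mul, Matrix.mul_assoc, ← Matrix.mul_assoc (planeRotation l m _ _),
          planeRotation_unitary (lt_of_pairAt hp).ne, Matrix.one_mul, ih]
      dsimp only
      split_ifs
      · rw [Matrix.conjTranspose_submatrix, Matrix.submatrix_mul_equiv, hW, Matrix.submatrix_id_id]
      · exact hW

lemma spectralForm_iterate {ev : Fin n → ℝ} (hG : SpectralForm G ev) (k : ℕ) :
    SpectralForm (iterate G θ φ k) ev :=
  hG.conj (state_unitary G θ φ k)

lemma state_snd {k : ℕ} (hk : sweepLength n ∣ k) : (state G θ φ k).2 = 1 := by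
  rcases k with _ | k
  · rfl
  · have h0 : 0 < sweepLength n := Nat.pos_of_dvd_of_pos hk k.succ_pos
    have hlt : k % sweepLength n < (sweepPairs n).length := by
      rw [length_sweepPairs]
      exact Nat.mod_lt _ h0
    have hp : pairAt n k = some (sweepPairs n)[k % sweepLength n] := List.getElem?_eq_getElem hlt
    rw [state_succ G θ φ hp]
    dsimp only
    rw [if_pos (Nat.mod_eq_zero_of_dvd hk)]

/-- The matrix `W` and the column table in the sweep that begins at stage `k`, without the
permutation of the columns at its end. -/
noncomputable def sweepState (k : ℕ) : ℕ → Matrix (Fin n) (Fin n) ℂ × Equiv.Perm (Fin n)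
  | 0 => ((state G θ φ k).1, 1)
  | t + 1 =>
    match (sweepPairs n)[t]? with
    | none => sweepState k t
    | some (l, m) =>
      let W := (sweepState k t).1 * planeRotation l m (θ (k + t)) (φ (k + t))
      (W, updateTable (Wᴴ * G * W) (sweepState k t).2 l m)

lemma sweepState_succ (k : ℕ) {t : ℕ} (ht : t < (sweepPairs n).length) :
    sweepState G θ φ k (t + 1) =
      let W := (sweepState G θ φ k t).1 *
        planeRotation (sweepPairs n)[t].1 (sweepPairs n)[t].2 (θ (k + t)) (φ (k + t))
      (W, updateTable (Wᴴ * G * W) (sweepState G θ φ k t).2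
        (sweepPairs n)[t].1 (sweepPairs n)[t].2) := by
  rw [sweepState, List.getElem?_eq_getElem ht]

lemma state_eq_sweepState {k : ℕ} (hk : sweepLength n ∣ k) :
    ∀ t < (sweepPairs n).length, state G θ φ (k + t) = sweepState G θ φ k t := by
  intro t
  induction t with
  | zero =>
    intro _
    rw [sweepState, add_zero, ← state_snd G θ φ hk]
  | succ t ih =>
    intro ht
    have ht' : t < (sweepPairs n).length := by omega
    rw [← add_assoc, state_succ G θ φ (pairAt_add hk ht'), sweepState_succ G θ φ k ht',
      ih ht']
    have hne : (k + t + 1) % sweepLength n ≠ 0 := by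
      obtain ⟨q, rfl⟩ := hk
      rw [length_sweepPairs] at ht
      rw [add_assoc, Nat.mul_add_mod, Nat.mod_eq_of_lt ht]
      omega
    dsimp only
    rw [if_neg hne]
    rfl

lemma state_add_sweepLength {k : ℕ} (hk : sweepLength n ∣ k) :
    (state G θ φ (k + sweepLength n)).1 =
      (sweepState G θ φ k (sweepLength n)).1.submatrix id
        (sweepState G θ φ k (sweepLength n)).2 := by
  rcases hm : sweepLength n with _ | t
  -- An empty sweep: no rotation and no permutation takes place.
  · simp [sweepState]
  · have ht : t < (sweepPairs n).length := by rw [length_sweepPairs]; omega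
    rw [← add_assoc, state_succ G θ φ (pairAt_add hk ht), sweepState_succ G θ φ k ht,
      state_eq_sweepState G θ φ hk t ht]
    have he : (k + t + 1) % sweepLength n = 0 := by
      rw [add_assoc, ← hm]
      exact Nat.mod_eq_zero_of_dvd (dvd_add hk dvd_rfl)
    dsimp only
    rw [if_pos he]
    rfl

variable {G θ φ} in
/-- A sweep of a run: the matrices without the final permutation, and the column tables. -/
lemma exists_sweep {η : ℝ} (h : IsRun G η θ φ) {k : ℕ} (hk : sweepLength n ∣ k) :
    ∃ (A : ℕ → Matrix (Fin n) (Fin n) ℂ) (I : ℕ → Equiv.Perm (Fin n)),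
      A 0 = iterate G θ φ k ∧ IsSweep η A ∧
      (∀ t (ht : t < (sweepPairs n).length),
        I (t + 1) = updateTable (A (t + 1)) (I t) (sweepPairs n)[t].1 (sweepPairs n)[t].2) ∧
      iterate G θ φ (k + sweepLength n) = (A (sweepPairs n).length).submatrix
        (I (sweepPairs n).length) (I (sweepPairs n).length) := by
  refine ⟨fun t => ((sweepState G θ φ k t).1)ᴴ * G * (sweepState G θ φ k t).1,
    fun t => (sweepState G θ φ k t).2, rfl, ?_, ?_, ?_⟩
  · intro t ht
    refine ⟨θ (k + t), φ (k + t), ?_, ?_⟩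
    · have := h (k + t) _ _ (pairAt_add hk ht)
      rwa [iterate, state_eq_sweepState G θ φ hk t ht] at this
    · dsimp only
      rw [sweepState_succ G θ φ k ht, rotate]
      simp only [Matrix.conjTranspose_mul, Matrix.mul_assoc]
  · intro t ht
    dsimp only
    rw [sweepState_succ G θ φ k ht]
  · rw [length_sweepPairs, iterate, state_add_sweepLength G θ φ hk]
    rfl

namespace IsSweep

variable {A : ℕ → Matrix (Fin n) (Fin n) ℂ} {I : ℕ → Equiv.Perm (Fin n)} {ev μ κ : Fin n → ℝ}
  {η s δ : ℝ}

/-- The column tables of a sweep sort the clusters. -/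
lemma antitone_table (hc : Clustered ev μ s δ) (hκ : ∀ i, κ i ∈ Set.range μ)
    (hnear : ∀ t ≤ (sweepPairs n).length, ∀ i, |(A t i i).re - κ i| ≤ δ / 2)
    (hI : ∀ t (ht : t < (sweepPairs n).length),
      I (t + 1) = updateTable (A (t + 1)) (I t) (sweepPairs n)[t].1 (sweepPairs n)[t].2) :
    Antitone (κ ∘ I (sweepPairs n).length) := by
  have hδ := hc.pos
  -- The sort is run on the centres, since the diagonal entries themselves change with every
  -- rotation.
  refine antitone_of_exchange (v := fun t => κ ∘ I t) fun t ht => ?_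
  have hcmp : ∀ i j, κ i < κ j → (A (t + 1) i i).re < (A (t + 1) j j).re := by
    intro i j hij
    by_contra hcon
    push Not at hcon
    have h1 := abs_le.1 (hnear (t + 1) ht i)
    have h2 := abs_le.1 (hnear (t + 1) ht j)
    obtain ⟨a, ha⟩ := hκ i
    obtain ⟨b, hb⟩ := hκ j
    have h3 := hc.sep a b (by rw [ha, hb]; exact hij.ne)
    rw [ha, hb, abs_of_neg (by linarith)] at h3
    linarith [h1.1, h1.2, h2.1, h2.2]
  have hI := hI t ht
  rw [updateTable] at hI
  generalize (sweepPairs n)[t] = q at *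
  obtain ⟨l, m⟩ := q
  simp only [Function.comp] at *
  constructor
  · intro hlt
    rw [if_neg (not_le.2 (hcmp _ _ hlt))] at hI
    rw [hI]
    rfl
  · intro hle
    split_ifs at hI with hA
    · rw [hI]
    -- An exchange within one cluster is invisible to the centres.
    · have he : κ (I t m) = κ (I t l) := by
        refine le_antisymm hle ?_
        by_contra hcon
        exact hA (hcmp _ _ (not_le.1 hcon)).le
      rw [hI]
      ext x
      rw [Function.comp_apply, Function.comp_apply, Equiv.Perm.mul_apply, Equiv.swap_apply_def]
      split_ifs with h1 h2
      · rw [h1, he]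
      · rw [h2, he]
      · rfl

end IsSweep

/-! ### Assembly of the two sweeps. -/

/-- The cluster collapses to `c` and every other eigenvalue is its own centre, so repeated
eigenvalues share one. Distinct centres then differ by an element of `gaps`. -/
lemma clustered_of_gaps {ev ξ : Fin n → ℝ} {L₂ : Finset (Fin n)} {c δ : ℝ}
    (hξ : ∀ l ∈ L₂, ev l = c + ξ l) (hgap : 3 * δ ∈ lowerBounds (gaps ev L₂ c))
    (hδ : 16 * Real.sqrt (∑ l ∈ L₂, ξ l ^ 2) < δ) :
    Clustered ev (fun l => if l ∈ L₂ then c else ev l) (Real.sqrt (∑ l ∈ L₂, ξ l ^ 2)) δ := by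
  have hs := Real.sqrt_nonneg (∑ l ∈ L₂, ξ l ^ 2)
  refine ⟨by linarith, hs, hδ.le, fun l => ?_, fun l r hlr => ?_⟩
  · split_ifs with hl
    · rw [hξ l hl, add_sub_cancel_left]
      exact Real.abs_le_sqrt (Finset.single_le_sum (f := fun l => ξ l ^ 2)
        (fun i _ => sq_nonneg _) hl)
    · rwa [sub_self, abs_zero]
  · split_ifs at hlr ⊢ with hl hr hr
    · exact absurd rfl hlr
    · rw [abs_sub_comm]
      exact hgap (Or.inr ⟨r, hr, rfl⟩)
    · exact hgap (Or.inr ⟨l, hl, rfl⟩)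
    · exact hgap (Or.inl ⟨l, r, hl, hr, hlr, rfl⟩)

/-- Two consecutive sweeps: the first one makes the clusters contiguous, the second one converges
quadratically. -/
lemma offNorm_sq_le_of_two_sweeps {A B : ℕ → Matrix (Fin n) (Fin n) ℂ}
    {I : ℕ → Equiv.Perm (Fin n)} {ev μ : Fin n → ℝ} {η s δ : ℝ} (hc : Clustered ev μ s δ)
    (hη : 0 ≤ η) (hA : IsSweep η A) (hB : IsSweep η B) (hA0 : SpectralForm (A 0) ev)
    (hI : ∀ t (ht : t < (sweepPairs n).length),
      I (t + 1) = updateTable (A (t + 1)) (I t) (sweepPairs n)[t].1 (sweepPairs n)[t].2)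
    (hAB : B 0 = (A (sweepPairs n).length).submatrix
      (I (sweepPairs n).length) (I (sweepPairs n).length))
    (hPA : offNorm (A 0) ^ 2 ≤ δ ^ 2 / 8) (hPB : 2 * δ * s ≤ offNorm (B 0) ^ 2) :
    offNorm (B (sweepPairs n).length) ^ 2 ≤
      (432 * (sweepLength n : ℝ) ^ 2 * n ^ 2 + 50 * n ^ 2 + 256) * (offNorm (B 0) ^ 2 / δ) ^ 2 +
        2 * ((n : ℝ) ^ 2 - n) * η ^ 2 * frobNorm (A 0) ^ 2 := by
  have hδ := hc.pos
  have hsδ := hc.small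
  have hB0 : SpectralForm (B 0) ev := by
    rw [hAB]
    exact (hA.spectralForm hA0 _ le_rfl).submatrix _
  have hN : frobNorm (B 0) = frobNorm (A 0) := by rw [hA0.frobNorm_eq, hB0.frobNorm_eq]
  have hAP := hA.offNorm_sq_le hA0
  have hBP := hB.offNorm_sq_le hB0
  have hquad := fun κ P => hB.offNorm_sq_le_quadratic (κ := κ) (P := P) hB0 hc
  have hAnear := fun κ => hA.diag_near (κ := κ) hA0 hc
  have hBnear := fun κ => hB.diag_near (κ := κ) hB0 hc
  rw [hN] at hBP hBnear hquad
  have hP0 := offNorm_nonneg (B 0)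
  have hN0 := frobNorm_nonneg (A 0)
  have hsmall : n ≤ 1 → offNorm (B 0) = 0 := by
    intro hn
    have h1 := frobNorm_mask_le (T := fun x y : Fin n => x ≠ y) (B := B 0) le_rfl fun x y hxy =>
      absurd (Fin.ext (by omega)) hxy
    rw [mul_zero] at h1
    have h2 := offNorm_sq hB0.isHermitian
    rw [le_antisymm h1 (frobNorm_nonneg _)] at h2
    nlinarith
  generalize frobNorm (A 0) = N at *
  generalize hP : offNorm (B 0) = P at *
  have hend := hBP _ le_rfl
  obtain ⟨X, hX⟩ : ∃ X, X = ((n : ℝ) ^ 2 - n) * η ^ 2 * N ^ 2 := ⟨_, rfl⟩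
  have hX0 : 0 ≤ X := by
    rw [hX, ← two_mul_sweepLength]
    positivity
  have hX54 : 5 / 4 * ((n : ℝ) ^ 2 - n) * η ^ 2 * N ^ 2 = 5 / 4 * X := by rw [hX]; ring
  have hX32 : 3 / 2 * ((n : ℝ) ^ 2 - n) * η ^ 2 * N ^ 2 = 3 / 2 * X := by rw [hX]; ring
  have hX2 : 2 * ((n : ℝ) ^ 2 - n) * η ^ 2 * N ^ 2 = 2 * X := by rw [hX]; ring
  rw [hX54] at hend hAP hBP
  rw [hX32] at hquad
  rw [hX2]
  obtain ⟨c, hcdef⟩ : ∃ c : ℝ, c = 432 * (sweepLength n : ℝ) ^ 2 * n ^ 2 + 50 * n ^ 2 := ⟨_, rfl⟩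
  have hc0 : 0 ≤ c := by rw [hcdef]; positivity
  rw [← hcdef] at hquad ⊢
  have hE0 : 0 ≤ (P ^ 2 / δ) ^ 2 := sq_nonneg _
  have hcE : 0 ≤ c * (P ^ 2 / δ) ^ 2 := mul_nonneg hc0 hE0
  -- For large `P` the term `256 * (P ^ 2 / δ) ^ 2` already dominates `P ^ 2`.
  by_cases hbig : δ / 16 < P
  · have h1 : P ^ 2 ≤ 256 * (P ^ 2 / δ) ^ 2 := by
      have h2 : 1 / 16 ≤ P / δ := by rw [le_div_iff₀ hδ]; linarith
      have h3 := pow_le_pow_left₀ (by norm_num) h2 2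
      have h4 : 256 * (P ^ 2 / δ) ^ 2 = 256 * (P / δ) ^ 2 * P ^ 2 := by ring
      rw [h4]
      refine le_mul_of_one_le_left (sq_nonneg _) ?_
      linarith
    linarith
  push Not at hbig
  -- If the errors dominate, `P ^ 2 + 5 / 4 * X ≤ 2 * X`.
  by_cases herr : 4 * P ^ 2 ≤ 3 * X
  · linarith
  push Not at herr
  -- For `n ≤ 1` both `P` and `X` vanish; `n ≥ 2` gives `n ^ 2 - n ≥ 2`, needed to extract `η * N ≤
  -- P`.
  have hn : 2 ≤ n := by
    by_contra hn
    rw [hsmall (by omega)] at herr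
    linarith
  have hηP : η * N ≤ P := by
    refine (sq_le_sq₀ (mul_nonneg hη hN0) hP0).1 ?_
    have hn' : (2 : ℝ) ≤ n := by exact_mod_cast hn
    have h1 : 2 * (η * N) ^ 2 ≤ X := by
      rw [hX, mul_assoc, ← mul_pow]
      exact mul_le_mul_of_nonneg_right (by nlinarith) (sq_nonneg _)
    linarith [sq_nonneg P]
  have hPsq : P ^ 2 ≤ δ ^ 2 / 256 := by
    have := pow_le_pow_left₀ hP0 hbig 2
    linarith
  have hA25 : ∀ t ≤ (sweepPairs n).length, offNorm (A t) ≤ 2 / 5 * δ := fun t ht => by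
    refine (sq_le_sq₀ (offNorm_nonneg _) (by positivity)).1 ?_
    have := hAP t ht
    linarith [sq_nonneg δ, mul_pow (2 / 5) δ 2]
  have hB2 : ∀ t ≤ (sweepPairs n).length, offNorm (B t) ≤ 2 * P := fun t ht => by
    refine (sq_le_sq₀ (offNorm_nonneg _) (by positivity)).1 ?_
    have := hBP t ht
    linarith [mul_pow 2 P 2]
  -- The lower bound on `P ^ 2` makes the cluster width a second-order quantity.
  have hsE : s ≤ P ^ 2 / δ := by
    rw [le_div_iff₀ hδ]
    linarith [mul_nonneg hδ.le hc.nonneg]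
  have hsP : s ≤ P := by
    refine hsE.trans ?_
    rw [div_le_iff₀ hδ, sq]
    exact mul_le_mul_of_nonneg_left (by linarith) hP0
  choose κ hκ hκ0 using fun i => hc.exists_center_near hA0 i
  have hA' : ∀ t ≤ (sweepPairs n).length, ∀ i, |(A t i i).re - κ i| ≤ δ / 2 := fun t ht i => by
    have h0 := hA25 0 (Nat.zero_le _)
    have h1 := hAnear κ hA25 (by linarith) hκ (fun i => by linarith [hκ0 i]) t ht i
    linarith [hA25 t ht]
  have hanti := IsSweep.antitone_table hc hκ hA' hI
  have hBκ : ∀ i, |(B 0 i i).re - (κ ∘ I (sweepPairs n).length) i| ≤ δ / 2 := fun i => by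
    rw [hAB]
    exact hA' _ le_rfl _
  have hB' := hBnear (κ ∘ I (sweepPairs n).length)
    (fun t ht => by linarith [hB2 t ht]) (by linarith) (fun i => hκ _) hBκ
  have hfin := hquad (κ ∘ I (sweepPairs n).length) P hanti (fun i => hκ _)
    (fun t ht i => by linarith [hB' t ht i, hB2 t ht]) hB2 hbig hη hηP hsE
  linarith

end OBNSLA

theorem theorem4 (n : ℕ) :
    ∃ C : ℝ, 0 < C ∧
      ∀ (G : Matrix (Fin n) (Fin n) ℂ) (hG : G.IsHermitian) (η : ℝ) (θ φ : ℕ → ℝ),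
        0 ≤ η → OBNSLA.IsRun G η θ φ →
      ∀ (L₂ : Finset (Fin n)) (c : ℝ) (ξ : Fin n → ℝ) (δ : ℝ),
        (∀ l ∈ L₂, hG.eigenvalues l = c + ξ l) →
        ∑ l ∈ L₂, ξ l = 0 →
        3 * δ ∈ lowerBounds (OBNSLA.gaps hG.eigenvalues L₂ c) →
        16 * Real.sqrt (∑ l ∈ L₂, ξ l ^ 2) < δ →
      ∀ k m : ℕ, m = OBNSLA.sweepLength n → m ∣ k →
        2 * δ * Real.sqrt (∑ l ∈ L₂, ξ l ^ 2) ≤ OBNSLA.P G θ φ k ^ 2 →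
        OBNSLA.P G θ φ k ^ 2 ≤ δ ^ 2 / 8 →
        2 * δ * Real.sqrt (∑ l ∈ L₂, ξ l ^ 2) ≤ OBNSLA.P G θ φ (k + m) ^ 2 →
        OBNSLA.P G θ φ (k + 2 * m) ^ 2 ≤
          C * (OBNSLA.P G θ φ (k + m) ^ 2 / δ) ^ 2
            + C * (η * OBNSLA.P G θ φ (k + m) ^ 3 / δ)
            + C * (η ^ 2 * OBNSLA.P G θ φ (k + m) / δ)
            + 2 * ((n : ℝ) ^ 2 - n) * η ^ 2 * OBNSLA.frobNorm G ^ 2 := by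
  refine ⟨432 * (OBNSLA.sweepLength n : ℝ) ^ 2 * n ^ 2 + 50 * n ^ 2 + 256, by positivity, ?_⟩
  rintro G hG η θ φ hη hrun L₂ c ξ δ hξ - hgap hsδ k m rfl hk - hPk hPkm
  have hc := OBNSLA.clustered_of_gaps hξ hgap hsδ
  have hδ := hc.pos
  have hsf := fun j => OBNSLA.spectralForm_iterate G θ φ (OBNSLA.spectralForm_eigenvalues hG) j
  obtain ⟨A, I, hA0, hA, hI, hAk⟩ := OBNSLA.exists_sweep hrun hk
  obtain ⟨B, J, hB0, hB, -, hBk⟩ :=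
    OBNSLA.exists_sweep hrun (dvd_add hk (dvd_refl (OBNSLA.sweepLength n)))
  have hAsf := hsf k
  have hBsf := hsf (k + OBNSLA.sweepLength n)
  rw [← hA0] at hAsf
  rw [← hB0] at hBsf
  have hN : OBNSLA.frobNorm (A 0) = OBNSLA.frobNorm G := by
    rw [hAsf.frobNorm_eq, (OBNSLA.spectralForm_eigenvalues hG).frobNorm_eq]
  have hPend : OBNSLA.P G θ φ (k + 2 * OBNSLA.sweepLength n) =
      OBNSLA.offNorm (B (OBNSLA.sweepPairs n).length) := by
    rw [OBNSLA.P, two_mul, ← add_assoc, hBk]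
    exact OBNSLA.offNorm_submatrix (hB.spectralForm hBsf _ le_rfl).isHermitian _
  have hP0 : 0 ≤ OBNSLA.P G θ φ (k + OBNSLA.sweepLength n) := OBNSLA.offNorm_nonneg _
  have hmain := OBNSLA.offNorm_sq_le_of_two_sweeps hc hη hA hB hAsf hI (hB0.trans hAk)
    (by rw [hA0]; exact hPk) (by rw [hB0]; exact hPkm)
  rw [hN, hB0, ← OBNSLA.P, ← hPend] at hmain
  generalize OBNSLA.P G θ φ (k + 2 * OBNSLA.sweepLength n) = p at *
  generalize OBNSLA.P G θ φ (k + OBNSLA.sweepLength n) = q at *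
  generalize OBNSLA.frobNorm G = N at *
  have hC : 0 ≤ 432 * (OBNSLA.sweepLength n : ℝ) ^ 2 * n ^ 2 + 50 * n ^ 2 + 256 := by positivity
  generalize 432 * (OBNSLA.sweepLength n : ℝ) ^ 2 * n ^ 2 + 50 * n ^ 2 + 256 = C at *
  have h1 : 0 ≤ C * (η * q ^ 3 / δ) := by positivity
  have h2 : 0 ≤ C * (η ^ 2 * q / δ) := by positivity
  linarith
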